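/- **Privacy of the Empirically Rescaled Gaussian Mechanism.** For a data set $x=(x_1,\dots,x_{3n})\in\mathbb{R}^{3n\times d}$ let $$\mu_x=\frac1n\sum_{i=1}^n x_{i+2n},\qquad \Sigma_x=\frac1{2n}\sum_{i=1}^n (x_i-x_{i+n})(x_i-x_{i+n})^T,$$ and for $\lambda\in\mathbb{R}$ let $\mathcal{G}(\lambda)$ be the set of all $x\in\mathbb{R}^{3n\times d}$ such that $\Sigma_x$ is invertible and $(x_i-\mu_x)^T\Sigma_x^{-1}(x_i-\mu_x)\le\lambda$ for all $i\in[3n]$. Let $D_H(x,y)=|\{i: x_i\ne y_i\}|$ be the Hamming distance, and $D_H(x,S)=\min_{z\in S}D_H(x,z)$, with $D_H(x,\emptyset)=\infty$. Given $\varepsilon,\delta,\beta>0$ and constants $K,c>0$, set $$\lambda=c\,d\log\frac n\beta,\quad t=\frac1\varepsilon\log\frac1\beta,\quad k=\frac2\varepsilon\log\frac1{\delta\beta}+1,\quad C^2=\frac{32k^2}{\varepsilon^2n^2}\cdot\frac{\lambda}{1-2k\lambda/n}\cdot\log\frac{1.25}{\delta}.$$ The mechanism $\mathcal{A}$ with constants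 $K,c$ does the following on input $x$. 1. If $n<K\cdot\frac{k\lambda}{\varepsilon}\log\frac1\delta$, return FAIL. 2. Let $\bar x$ be a uniformly random permutation of the records of $x$, and let $h=D_H(\bar x,\mathcal{G}(\lambda))$. 3. Draw $r\sim\mathrm{Lap}(1/\varepsilon)$ (density $\frac{\varepsilon}{2}e^{-\varepsilon|r|}$). If $h+r>t$, return FAIL. 4. Let $\tilde x\in\arg\min_{z\in\mathcal{G}(\lambda)}D_H(\bar x,z)$, where ties are broken by an arbitrary fixed rule depending on $\bar x$, and return a sample of $\mathcal{N}(\mu_{\tilde x},C^2\Sigma_{\tilde x})$. (If $C^2\le 0$ or $C^2$ involves a division by zero, return $\mu_{\tilde x}$.) There is an absolute constant $K_0>0$ such that for all $K\ge K_0$ and $c>0$, all $n$ and $d$, all $\varepsilon>0$, $0<\delta<1$, $\beta>0$, and every tie-breaking rule, $\mathcal{A}$ is $(3\varepsilon,\,e^{\varepsilon}(1+e^{\varepsilon})\delta)$-differentially private: for all data sets $x,y$ with $D_H(x,y)\le1$, and every measurable set $E\subseteq\mathbb{R}^d\cup\{\mathrm{FAIL}\}$, $$\Pr[\mathcal{A}(x)\in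 E]\le e^{3\varepsilon}\Pr[\mathcal{A}(y)\in E]+e^{\varepsilon}(1+e^{\varepsilon})\delta,$$ and the same with $x$ and $y$ exchanged. The same holds for all $x,y$ that differ in at most one record as multisets, i.e. for which some reordering $y'$ of the records of $y$ satisfies $D_H(x,y')\le 1$. -/

import Mathlib

open MeasureTheory ProbabilityTheory
open scoped ENNReal

/-! ### Differential privacy -/

/-- `(ε, δ)`-indistinguishability of two distributions `P`, `Q` on the same space. -/
def Indistinguishable {W : Type*} [MeasurableSpace W] (ε δ : ℝ) (P Q : Measure W) : Prop :=
  ∀ E : Set W, MeasurableSet E →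
    P E ≤ ENNReal.ofReal (Real.exp ε) * Q E + ENNReal.ofReal δ ∧
    Q E ≤ ENNReal.ofReal (Real.exp ε) * P E + ENNReal.ofReal δ

/-- `(ε, δ)`-differential privacy with respect to a neighboring relation `nbr`, for a randomized
algorithm `A` (`A x` is the distribution of the output on input `x`). -/
def IsDifferentiallyPrivate {X W : Type*} [MeasurableSpace W] (nbr : X → X → Prop)
    (ε δ : ℝ) (A : X → Measure W) : Prop :=
  ∀ x y : X, nbr x y → Indistinguishable ε δ (A x) (A y)

/-! ### Data sets and the Hamming distance -/

/-- Data sets of `m` records, each a point of `ℝ^d`. -/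
abbrev DataSet (m d : ℕ) : Type := Fin m → EuclideanSpace ℝ (Fin d)

open Classical in
/-- The Hamming distance `D_H(x, y) = |{i : x_i ≠ y_i}|`. -/
noncomputable def dataDist {m d : ℕ} (x y : DataSet m d) : ℕ := hammingDist x y

/-- The Hamming distance `D_H(x, S) = min_{z ∈ S} D_H(x, z)` to a set; it is `⊤` for `S = ∅`. -/
noncomputable def dataDistToSet {m d : ℕ} (x : DataSet m d) (S : Set (DataSet m d)) : ℕ∞ :=
  ⨅ z ∈ S, (dataDist x z : ℕ∞)

/-- Neighboring data sets: `D_H(x, y) ≤ 1`. -/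
def Neighboring {m d : ℕ} (x y : DataSet m d) : Prop := dataDist x y ≤ 1

/-- Data sets that, regarded as multisets of records, differ in at most one record: some
reordering of the records of `y` has Hamming distance at most one from `x`. -/
def MultisetNeighboring {m d : ℕ} (x y : DataSet m d) : Prop :=
  ∃ π : Equiv.Perm (Fin m), dataDist x (y ∘ π) ≤ 1

/-! ### Empirical mean and covariance, goodness -/

/-- `μ_x = (1/n) ∑_{i=1}^n x_{i+2n}`. -/
noncomputable def empMean {n d : ℕ} (x : DataSet (3 * n) d) : EuclideanSpace ℝ (Fin d) :=
  (1 / (n : ℝ)) • ∑ i : Fin n, x ⟨i + 2 * n, by omega⟩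

/-- The paired difference `x_i - x_{i+n}`, for `1 ≤ i ≤ n`. -/
noncomputable def pairDiff {n d : ℕ} (x : DataSet (3 * n) d) (i : Fin n) :
    EuclideanSpace ℝ (Fin d) :=
  x ⟨i, by omega⟩ - x ⟨i + n, by omega⟩

/-- `Σ_x = (1/(2n)) ∑_{i=1}^n (x_i - x_{i+n}) (x_i - x_{i+n})ᵀ`. -/
noncomputable def empCov {n d : ℕ} (x : DataSet (3 * n) d) : Matrix (Fin d) (Fin d) ℝ :=
  (1 / (2 * (n : ℝ))) • ∑ i : Fin n, Matrix.vecMulVec (pairDiff x i).ofLp (pairDiff x i).ofLp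

/-- The squared Mahalanobis norm `‖v‖_S² = vᵀ S⁻¹ v` (used for invertible `S` only). -/
noncomputable def mahalanobisSq {d : ℕ} (S : Matrix (Fin d) (Fin d) ℝ)
    (v : EuclideanSpace ℝ (Fin d)) : ℝ :=
  v.ofLp ⬝ᵥ (S⁻¹).mulVec v.ofLp

/-- The set `G(lam)` of `lam`-good data sets. -/
def goodSet (n d : ℕ) (lam : ℝ) : Set (DataSet (3 * n) d) :=
  {x | IsUnit (empCov x) ∧ ∀ i, mahalanobisSq (empCov x) (x i - empMean x) ≤ lam}

/-- `proj` is a nearest-point projection onto `S` in Hamming distance, that is,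
`proj x ∈ argmin_{z ∈ S} D_H(x, z)` with ties broken in any way (no condition if `S = ∅`). -/
def IsProjection {m d : ℕ} (S : Set (DataSet m d)) (proj : DataSet m d → DataSet m d) : Prop :=
  S.Nonempty → ∀ x, proj x ∈ S ∧ ∀ z ∈ S, dataDist x (proj x) ≤ dataDist x z

/-- Such projections exist. -/
theorem exists_isProjection {m d : ℕ} (S : Set (DataSet m d)) : ∃ proj, IsProjection S proj := by
  by_cases hS : S.Nonempty
  · have h : ∀ x : DataSet m d, ∃ p, p ∈ S ∧ ∀ z ∈ S, dataDist x p ≤ dataDist x z := fun x =>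
      ⟨Function.argminOn (dataDist x) S hS, Function.argminOn_mem _ _ _,
        fun z hz => Function.argminOn_le _ _ hz⟩
    choose p hp using h
    exact ⟨p, fun _ => hp⟩
  · exact ⟨id, fun h => absurd h hS⟩

/-! ### Noise distributions -/

/-- The centered Laplace distribution `Lap(b)`, with density `exp (-|r| / b) / (2 b)`. -/
noncomputable def laplace (b : ℝ) : Measure ℝ :=
  volume.withDensity fun r => ENNReal.ofReal (Real.exp (-|r| / b) / (2 * b))

theorem isProbabilityMeasure_laplace {b : ℝ} (hb : 0 < b) : IsProbabilityMeasure (laplace b) := by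
  constructor
  have hI : ∫ r : ℝ, Real.exp (-|r| / b) / (2 * b) = 1 := by
    have h1 : ∫ r : ℝ, Real.exp (-|r| / b) / (2 * b)
        = 2 * ∫ r in Set.Ioi (0 : ℝ), Real.exp (-r / b) / (2 * b) :=
      integral_comp_abs (f := fun r => Real.exp (-r / b) / (2 * b))
    have h2 : ∫ r in Set.Ioi (0 : ℝ), Real.exp (-r / b) = b := by
      have := integral_exp_mul_Ioi (a := -b⁻¹) (by simpa using hb) 0
      simpa [div_eq_mul_inv, mul_comm] using this
    rw [h1, integral_div, h2]
    field_simp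
  have hint : Integrable (fun r : ℝ => Real.exp (-|r| / b) / (2 * b)) := by
    by_contra hc
    rw [integral_undef hc] at hI
    exact zero_ne_one hI
  rw [laplace, withDensity_apply _ MeasurableSet.univ, Measure.restrict_univ,
    ← ofReal_integral_eq_lintegral_ofReal hint (Filter.Eventually.of_forall fun r => by positivity),
    hI, ENNReal.ofReal_one]

/-! ### The Empirically Rescaled Gaussian Mechanism -/

/-- Outputs of the mechanism: a point of `ℝ^d`, or `FAIL`. -/
abbrev Output (d : ℕ) : Type := EuclideanSpace ℝ (Fin d) ⊕ Unit

/-- The output `FAIL`. -/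
abbrev outFail {d : ℕ} : Output d := Sum.inr ()

/-- `λ = c · d · log (n / β)`, where `c` is the constant hidden in `λ = O(d log (n / β))`. -/
noncomputable def lamParam (c : ℝ) (n d : ℕ) (β : ℝ) : ℝ := c * (d * Real.log (n / β))

/-- `t = (1/ε) log (1/β)`. -/
noncomputable def tParam (ε β : ℝ) : ℝ := 1 / ε * Real.log (1 / β)

/-- `k = (2/ε) log (1/(δβ)) + 1`. -/
noncomputable def kParam (ε δ β : ℝ) : ℝ := 2 / ε * Real.log (1 / (δ * β)) + 1

/-- `C² = (32 k² / (ε² n²)) · (λ / (1 - 2kλ/n)) · log (1.25/δ)`. -/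
noncomputable def noiseScaleSq (n : ℕ) (ε δ lam k : ℝ) : ℝ :=
  32 * k ^ 2 / (ε ^ 2 * (n : ℝ) ^ 2) * (lam / (1 - 2 * k * lam / n)) * Real.log (1.25 / δ)

/-- The steps after the permutation, run on the permuted data set `x`: with
`h = D_H(x, G(lam))` and `r ∼ Lap(1/ε)`, return `FAIL` if `h + r > t` (in particular if
`h = ∞`); otherwise return a sample of `N(μ_z, C² Σ_z)`, where `z = proj x`.
(`multivariateGaussian μ S` is the point mass at `μ` when `S` is not positive semidefinite.) -/
noncomputable def afterPermutation {n d : ℕ} (ε t lam Csq : ℝ)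
    (proj : DataSet (3 * n) d → DataSet (3 * n) d) (x : DataSet (3 * n) d) : Measure (Output d) :=
  open Classical in
  (laplace (1 / ε)).bind fun r =>
    if dataDistToSet x (goodSet n d lam) = ⊤ ∨
        ((dataDistToSet x (goodSet n d lam)).toNat : ℝ) + r > t then
      Measure.dirac outFail
    else
      (multivariateGaussian (empMean (proj x)) (Csq • empCov (proj x))).map Sum.inl

/-- The distribution of the output of the Empirically Rescaled Gaussian Mechanism on the data set
`x`. The constant `K` is the one hidden in the sample size test
`n = o((k λ / ε) log (1/δ))`, and `c` is the one hidden in `λ`. -/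
noncomputable def rescaledGaussian (K c : ℝ) {n d : ℕ} (ε δ β : ℝ)
    (proj : DataSet (3 * n) d → DataSet (3 * n) d) (x : DataSet (3 * n) d) : Measure (Output d) :=
  let lam := lamParam c n d β
  let t := tParam ε β
  let k := kParam ε δ β
  let Csq := noiseScaleSq n ε δ lam k
  open Classical in
  if (n : ℝ) < K * (k * lam / ε * Real.log (1 / δ)) then
    Measure.dirac outFail
  else
    -- uniformly random permutation of the records
    ∑ σ : Equiv.Perm (Fin (3 * n)),
      (Fintype.card (Equiv.Perm (Fin (3 * n))) : ℝ≥0∞)⁻¹ •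
        afterPermutation ε t lam Csq proj (x ∘ σ)

theorem isProbabilityMeasure_afterPermutation {n d : ℕ} {ε : ℝ} (hε : 0 < ε) (t lam Csq : ℝ)
    (proj : DataSet (3 * n) d → DataSet (3 * n) d) (x : DataSet (3 * n) d) :
    IsProbabilityMeasure (afterPermutation ε t lam Csq proj x) := by
  classical
  have := isProbabilityMeasure_laplace (one_div_pos.mpr hε)
  unfold afterPermutation
  refine isProbabilityMeasure_bind (Measurable.aemeasurable ?_) (Filter.Eventually.of_forall ?_)
  · refine Measurable.ite ?_ measurable_const measurable_const
    refine MeasurableSet.union (MeasurableSet.const _) ?_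
    exact measurableSet_lt measurable_const (measurable_const.add measurable_id)
  · intro r
    split_ifs
    · infer_instance
    · exact Measure.isProbabilityMeasure_map measurable_inl.aemeasurable

/-- The mechanism is a randomized algorithm: its output has a probability distribution. -/
theorem isProbabilityMeasure_rescaledGaussian (K c : ℝ) {n d : ℕ} {ε : ℝ} (hε : 0 < ε) (δ β : ℝ)
    (proj : DataSet (3 * n) d → DataSet (3 * n) d) (x : DataSet (3 * n) d) :
    IsProbabilityMeasure (rescaledGaussian K c ε δ β proj x) := by
  classical
  unfold rescaledGaussian
  dsimp only
  split_ifs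
  · infer_instance
  · constructor
    have h := fun y => (isProbabilityMeasure_afterPermutation hε (tParam ε β) (lamParam c n d β)
      (noiseScaleSq n ε δ (lamParam c n d β) (kParam ε δ β)) proj y).measure_univ
    simp only [Measure.coe_finsetSum, Finset.sum_apply, Measure.smul_apply, h, smul_eq_mul,
      mul_one, Finset.sum_const, Finset.card_univ, nsmul_eq_mul]
    exact ENNReal.mul_inv_cancel (by simp [Fintype.card_ne_zero]) (ENNReal.natCast_ne_top _)

/-!
The mechanism follows the propose-test-release pattern. The Hamming distance to the good set changes
by at most one between neighbouring data sets, so the Laplace test costs `ε`; and unless the test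
passes with probability at most `e^ε δ`, the two projections differ in at most `k` records.

Let two good data sets differ in at most `k` records and put `γ = 2kλ/n`. A change of basis turns
their covariances into the identity and a diagonal matrix `D`. A pair of records contributes at most
`2λ/n` to the trace of the whitened covariance, so replacing `k` pairs gives
`∑ |1 - 1/D_i| ≤ 3γ`; similarly the means are close in Mahalanobis norm. The released Gaussians are
compared through an intermediate one, first shifting the mean and then changing the covariance, and
each step costs `(ε, δ)` by Markov's inequality for the moment of order `α = 2 log(1/δ)/ε` of the
likelihood ratio.
-/

/-! ### One-sided approximate max-divergence -/

/-- The one-sided half of `(ε, δ)`-indistinguishability: the `δ`-approximate max-divergence of `P`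
from `Q` is at most `ε`. -/
def MaxDivergenceLE {W : Type*} [MeasurableSpace W] (ε δ : ℝ) (P Q : Measure W) : Prop :=
  ∀ E : Set W, MeasurableSet E → P E ≤ ENNReal.ofReal (Real.exp ε) * Q E + ENNReal.ofReal δ

theorem indistinguishable_iff_maxDivergenceLE {W : Type*} [MeasurableSpace W] {ε δ : ℝ}
    {P Q : Measure W} :
    Indistinguishable ε δ P Q ↔ MaxDivergenceLE ε δ P Q ∧ MaxDivergenceLE ε δ Q P :=
  ⟨fun h => ⟨fun E hE => (h E hE).1, fun E hE => (h E hE).2⟩, fun h E hE => ⟨h.1 E hE, h.2 E hE⟩⟩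

theorem ofReal_exp_add (a b : ℝ) :
    ENNReal.ofReal (Real.exp (a + b))
      = ENNReal.ofReal (Real.exp a) * ENNReal.ofReal (Real.exp b) := by
  rw [Real.exp_add, ENNReal.ofReal_mul (Real.exp_nonneg a)]

theorem one_le_ofReal_exp {ε : ℝ} (hε : 0 ≤ ε) : 1 ≤ ENNReal.ofReal (Real.exp ε) :=
  ENNReal.one_le_ofReal.2 (Real.one_le_exp hε)

namespace MaxDivergenceLE

variable {W W' : Type*} [MeasurableSpace W] [MeasurableSpace W'] {ε ε' δ δ' : ℝ}
  {P Q R : Measure W}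

theorem refl (hε : 0 ≤ ε) (P : Measure W) : MaxDivergenceLE ε δ P P := fun _ _ =>
  (le_mul_of_one_le_left zero_le (one_le_ofReal_exp hε)).trans le_self_add

theorem of_one_le [IsProbabilityMeasure P] (hδ : 1 ≤ δ) : MaxDivergenceLE ε δ P Q := fun _ _ =>
  (prob_le_one.trans (ENNReal.one_le_ofReal.2 hδ)).trans le_add_self

theorem mono (h : MaxDivergenceLE ε δ P Q) (hε : ε ≤ ε') (hδ : δ ≤ δ') :
    MaxDivergenceLE ε' δ' P Q := fun _ hE => (h _ hE).trans <| by gcongr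

theorem trans (hPQ : MaxDivergenceLE ε δ P Q) (hQR : MaxDivergenceLE ε' δ' Q R) (hδ : 0 ≤ δ)
    (hδ' : 0 ≤ δ') : MaxDivergenceLE (ε + ε') (δ + Real.exp ε * δ') P R := fun E hE => by
  rw [ofReal_exp_add, add_comm δ, ENNReal.ofReal_add (by positivity) hδ,
    ENNReal.ofReal_mul (Real.exp_nonneg ε)]
  calc P E ≤ ENNReal.ofReal (Real.exp ε) * Q E + ENNReal.ofReal δ := hPQ E hE
    _ ≤ ENNReal.ofReal (Real.exp ε) * (ENNReal.ofReal (Real.exp ε') * R E + ENNReal.ofReal δ')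
        + ENNReal.ofReal δ := by gcongr; exact hQR E hE
    _ = _ := by ring

theorem map (h : MaxDivergenceLE ε δ P Q) {f : W → W'} (hf : Measurable f) :
    MaxDivergenceLE ε δ (P.map f) (Q.map f) := fun E hE => by
  rw [Measure.map_apply hf hE, Measure.map_apply hf hE]
  exact h _ (hf hE)

theorem uniform_mixture {ι : Type*} [Fintype ι] [Nonempty ι] {P Q : ι → Measure W}
    (h : ∀ i, MaxDivergenceLE ε δ (P i) (Q i)) :
    MaxDivergenceLE ε δ (∑ i, (Fintype.card ι : ℝ≥0∞)⁻¹ • P i)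
      (∑ i, (Fintype.card ι : ℝ≥0∞)⁻¹ • Q i) := fun E hE => by
  simp only [Measure.coe_finsetSum, Finset.sum_apply, Measure.smul_apply, smul_eq_mul,
    ← Finset.mul_sum]
  set N : ℝ≥0∞ := (Fintype.card ι : ℝ≥0∞)
  have hN : N⁻¹ * N = 1 :=
    ENNReal.inv_mul_cancel (by simp [N, Fintype.card_ne_zero]) (ENNReal.natCast_ne_top _)
  calc N⁻¹ * ∑ i, P i E
      ≤ N⁻¹ * ∑ i, (ENNReal.ofReal (Real.exp ε) * Q i E + ENNReal.ofReal δ) := by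
        gcongr with i
        exact h i E hE
    _ = ENNReal.ofReal (Real.exp ε) * (N⁻¹ * ∑ i, Q i E) + N⁻¹ * N * ENNReal.ofReal δ := by
        rw [Finset.sum_add_distrib, ← Finset.mul_sum, Finset.sum_const, Finset.card_univ,
          nsmul_eq_mul]
        ring
    _ = _ := by rw [hN, one_mul]

theorem mixture {q₁ q₂ p₁ p₂ : ℝ≥0∞} {F G₁ G₂ : Measure W}
    (hq : q₁ ≤ ENNReal.ofReal (Real.exp ε) * q₂) (hp : p₁ ≤ ENNReal.ofReal (Real.exp ε) * p₂)
    (hp₂ : p₂ ≤ 1) (hε' : 0 ≤ ε') (hG : MaxDivergenceLE ε' δ G₁ G₂) :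
    MaxDivergenceLE (ε + ε') (Real.exp ε * δ) (q₁ • F + p₁ • G₁) (q₂ • F + p₂ • G₂) :=
  fun E hE => by
  rw [ofReal_exp_add, ENNReal.ofReal_mul (Real.exp_nonneg ε)]
  simp only [Measure.add_apply, Measure.smul_apply, smul_eq_mul]
  set a := ENNReal.ofReal (Real.exp ε)
  set b := ENNReal.ofReal (Real.exp ε')
  have hb : 1 ≤ b := one_le_ofReal_exp hε'
  calc q₁ * F E + p₁ * G₁ E
      ≤ a * q₂ * F E + a * p₂ * (b * G₂ E + ENNReal.ofReal δ) := by gcongr; exact hG E hE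
    _ = a * 1 * (q₂ * F E) + a * b * (p₂ * G₂ E) + a * p₂ * ENNReal.ofReal δ := by ring
    _ ≤ a * b * (q₂ * F E) + a * b * (p₂ * G₂ E) + a * 1 * ENNReal.ofReal δ := by gcongr
    _ = _ := by ring

theorem mixture_of_le {q₁ q₂ p₁ p₂ : ℝ≥0∞} {F G₁ G₂ : Measure W} [IsProbabilityMeasure G₁]
    (hq : q₁ ≤ ENNReal.ofReal (Real.exp ε) * q₂) (hp : p₁ ≤ ENNReal.ofReal δ) :
    MaxDivergenceLE ε δ (q₁ • F + p₁ • G₁) (q₂ • F + p₂ • G₂) := fun E _ => by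
  simp only [Measure.add_apply, Measure.smul_apply, smul_eq_mul]
  calc q₁ * F E + p₁ * G₁ E
      ≤ ENNReal.ofReal (Real.exp ε) * q₂ * F E + ENNReal.ofReal δ * 1 := by
        gcongr
        exact prob_le_one
    _ ≤ ENNReal.ofReal (Real.exp ε) * (q₂ * F E + p₂ * G₂ E) + ENNReal.ofReal δ := by
        rw [mul_one, mul_assoc]
        gcongr
        exact le_self_add

theorem of_withDensity_exp {g : W → ℝ} (hg : Measurable g)
    (hPQ : P = Q.withDensity fun x => ENNReal.ofReal (Real.exp (g x)))
    (htail : P {x | ε ≤ g x} ≤ ENNReal.ofReal δ) : MaxDivergenceLE ε δ P Q := fun E hE => by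
  have hlow : P (E ∩ {x | g x < ε}) ≤ ENNReal.ofReal (Real.exp ε) * Q E := by
    have hS : MeasurableSet {x | g x < ε} := measurableSet_lt hg measurable_const
    rw [hPQ, withDensity_apply _ (hE.inter hS)]
    calc ∫⁻ x in E ∩ {x | g x < ε}, ENNReal.ofReal (Real.exp (g x)) ∂Q
        ≤ ∫⁻ _ in E ∩ {x | g x < ε}, ENNReal.ofReal (Real.exp ε) ∂Q :=
          setLIntegral_mono measurable_const fun x hx =>
            ENNReal.ofReal_le_ofReal (Real.exp_le_exp.2 (le_of_lt hx.2))
      _ = ENNReal.ofReal (Real.exp ε) * Q (E ∩ {x | g x < ε}) := setLIntegral_const _ _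
      _ ≤ ENNReal.ofReal (Real.exp ε) * Q E := by gcongr; exact Set.inter_subset_left
  have hsplit : E ⊆ E ∩ {x | g x < ε} ∪ {x | ε ≤ g x} := fun x hx =>
    (lt_or_ge (g x) ε).imp (fun h => ⟨hx, h⟩) id
  exact (measure_mono hsplit).trans ((measure_union_le _ _).trans (add_le_add hlow htail))

theorem of_withDensity_exp_of_moment {g : W → ℝ} (hg : Measurable g)
    (hPQ : P = Q.withDensity fun x => ENNReal.ofReal (Real.exp (g x))) {α : ℝ} (hα : 0 < α)
    (hmoment : ∫⁻ x, ENNReal.ofReal (Real.exp (α * g x)) ∂P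
      ≤ ENNReal.ofReal (Real.exp (α * ε) * δ)) : MaxDivergenceLE ε δ P Q := by
  refine of_withDensity_exp hg hPQ ?_
  have hset : {x | ε ≤ g x}
      = {x | ENNReal.ofReal (Real.exp (α * ε)) ≤ ENNReal.ofReal (Real.exp (α * g x))} := by
    ext x
    rw [Set.mem_ofPred_eq, Set.mem_ofPred_eq, ENNReal.ofReal_le_ofReal_iff (Real.exp_nonneg _),
      Real.exp_le_exp, mul_le_mul_iff_right₀ hα]
  have hmarkov := (mul_meas_ge_le_lintegral (μ := P)
    (f := fun x => ENNReal.ofReal (Real.exp (α * g x))) (by fun_prop)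
    (ENNReal.ofReal (Real.exp (α * ε)))).trans hmoment
  rw [← hset, ENNReal.ofReal_mul (Real.exp_nonneg _)] at hmarkov
  exact (ENNReal.mul_le_mul_iff_right (by simp [Real.exp_pos]) ENNReal.ofReal_ne_top).1 hmarkov

end MaxDivergenceLE

/-! ### Privacy loss of product measures -/

section Pi

variable {ι : Type*} [Fintype ι] {X : ι → Type*}

theorem indicator_univ_pi_prod (s : ∀ i, Set (X i)) (f : ∀ i, X i → ℝ≥0∞) :
    (Set.univ.pi s).indicator (fun x => ∏ i, f i (x i))
      = fun x => ∏ i, (s i).indicator (f i) (x i) := by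
  ext x
  by_cases hx : x ∈ Set.univ.pi s
  · rw [Set.indicator_of_mem hx]
    exact Finset.prod_congr rfl fun i _ => (Set.indicator_of_mem (hx i (Set.mem_univ i)) _).symm
  · rw [Set.indicator_of_notMem hx]
    simp only [Set.mem_pi, Set.mem_univ, true_imp_iff, not_forall] at hx
    obtain ⟨i, hi⟩ := hx
    exact (Finset.prod_eq_zero (Finset.mem_univ i) (Set.indicator_of_notMem hi _)).symm

variable [∀ i, MeasurableSpace (X i)]

theorem lintegral_pi_prod_eq_prod (μ : ∀ i, Measure (X i)) [∀ i, IsProbabilityMeasure (μ i)]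
    {f : ∀ i, X i → ℝ≥0∞} (hf : ∀ i, Measurable (f i)) :
    ∫⁻ x, ∏ i, f i (x i) ∂Measure.pi μ = ∏ i, ∫⁻ x, f i x ∂μ i := by
  refine (lintegral_prod_eq_prod_lintegral_of_indepFun Finset.univ
    (fun i (x : ∀ i, X i) => f i (x i)) (iIndepFun_pi (μ := μ) fun i => (hf i).aemeasurable)
    (fun i => (hf i).comp (measurable_pi_apply i))).trans ?_
  exact Finset.prod_congr rfl fun i _ => (measurePreserving_eval μ i).lintegral_comp (hf i)

theorem pi_eq_withDensity_prod {P Q : ∀ i, Measure (X i)} [∀ i, IsProbabilityMeasure (P i)]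
    [∀ i, IsProbabilityMeasure (Q i)] {f : ∀ i, X i → ℝ≥0∞} (hf : ∀ i, Measurable (f i))
    (hPQ : ∀ i, P i = (Q i).withDensity (f i)) :
    Measure.pi P = (Measure.pi Q).withDensity fun x => ∏ i, f i (x i) := by
  refine Measure.pi_eq fun s hs => ?_
  have hbox : MeasurableSet (Set.univ.pi s) := MeasurableSet.univ_pi hs
  rw [withDensity_apply _ hbox, ← lintegral_indicator hbox, indicator_univ_pi_prod,
    lintegral_pi_prod_eq_prod Q fun i => (hf i).indicator (hs i)]
  refine Finset.prod_congr rfl fun i _ => ?_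
  rw [lintegral_indicator (hs i), hPQ, withDensity_apply _ (hs i)]

theorem MaxDivergenceLE.pi_of_moment {P Q : ∀ i, Measure (X i)}
    [∀ i, IsProbabilityMeasure (P i)] [∀ i, IsProbabilityMeasure (Q i)]
    {g : ∀ i, X i → ℝ} (hg : ∀ i, Measurable (g i))
    (hPQ : ∀ i, P i = (Q i).withDensity fun x => ENNReal.ofReal (Real.exp (g i x)))
    {α ε δ : ℝ} (hα : 0 < α) (b : ι → ℝ)
    (hmoment : ∀ i, ∫⁻ x, ENNReal.ofReal (Real.exp (α * g i x)) ∂P i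
      ≤ ENNReal.ofReal (Real.exp (b i)))
    (hb : Real.exp (∑ i, b i) ≤ Real.exp (α * ε) * δ) :
    MaxDivergenceLE ε δ (Measure.pi P) (Measure.pi Q) := by
  have hexp : ∀ (c : ℝ) (x : ∀ i, X i), ENNReal.ofReal (Real.exp (c * ∑ i, g i (x i)))
      = ∏ i, ENNReal.ofReal (Real.exp (c * g i (x i))) := fun c x => by
    rw [Finset.mul_sum, Real.exp_sum, ENNReal.ofReal_prod_of_nonneg fun i _ => Real.exp_nonneg _]
  refine MaxDivergenceLE.of_withDensity_exp_of_moment (g := fun x => ∑ i, g i (x i))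
    (by fun_prop) ?_ hα ?_
  · rw [pi_eq_withDensity_prod (fun i => by have := hg i; fun_prop) hPQ]
    congr 1
    ext x
    simpa only [one_mul] using (hexp 1 x).symm
  · calc ∫⁻ x, ENNReal.ofReal (Real.exp (α * ∑ i, g i (x i))) ∂Measure.pi P
        = ∏ i, ∫⁻ x, ENNReal.ofReal (Real.exp (α * g i x)) ∂P i := by
          simp_rw [hexp α]
          exact lintegral_pi_prod_eq_prod P
            (f := fun i x => ENNReal.ofReal (Real.exp (α * g i x)))
            fun i => by have := hg i; fun_prop
      _ ≤ ∏ i, ENNReal.ofReal (Real.exp (b i)) := Finset.prod_le_prod' fun i _ => hmoment i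
      _ = ENNReal.ofReal (Real.exp (∑ i, b i)) := by
          rw [← ENNReal.ofReal_prod_of_nonneg fun i _ => Real.exp_nonneg _, ← Real.exp_sum]
      _ ≤ ENNReal.ofReal (Real.exp (α * ε) * δ) := ENNReal.ofReal_le_ofReal hb

end Pi

/-! ### Privacy loss of standard and diagonal Gaussian measures -/

theorem gaussianReal_eq_withDensity_exp (μ₁ μ₂ : ℝ) {v₁ v₂ : NNReal} (h₁ : v₁ ≠ 0) (h₂ : v₂ ≠ 0) :
    gaussianReal μ₁ v₁ = (gaussianReal μ₂ v₂).withDensity fun x => ENNReal.ofReal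
      (Real.exp (Real.log (v₂ / v₁) / 2 + (x - μ₂) ^ 2 / (2 * v₂) - (x - μ₁) ^ 2 / (2 * v₁))) := by
  have : (0 : ℝ) < v₁ := by positivity
  have hv₂ : (0 : ℝ) < v₂ := by positivity
  rw [gaussianReal_of_var_ne_zero _ h₁, gaussianReal_of_var_ne_zero _ h₂,
    ← withDensity_mul _ (measurable_gaussianPDF _ _) (by fun_prop)]
  congr 1
  ext x
  have hsqrt : Real.exp (Real.log (v₂ / v₁) / 2) = √v₂ / √v₁ := by
    rw [← Real.log_sqrt (by positivity), Real.exp_log (by positivity), Real.sqrt_div hv₂.le]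
  have hexp : -(x - μ₂) ^ 2 / (2 * v₂)
      + (Real.log (v₂ / v₁) / 2 + (x - μ₂) ^ 2 / (2 * v₂) - (x - μ₁) ^ 2 / (2 * v₁))
      = Real.log (v₂ / v₁) / 2 + -(x - μ₁) ^ 2 / (2 * v₁) := by ring
  rw [Pi.mul_apply, gaussianPDF, gaussianPDF, ← ENNReal.ofReal_mul (gaussianPDFReal_nonneg _ _ _),
    gaussianPDFReal, gaussianPDFReal, mul_assoc _ (Real.exp _), ← Real.exp_add, hexp,
    Real.exp_add, hsqrt, Real.sqrt_mul (by positivity) (v₁ : ℝ),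
    Real.sqrt_mul (by positivity) (v₂ : ℝ)]
  congr 1
  field_simp

theorem gaussianReal_eq_withDensity_shift (m : ℝ) :
    gaussianReal m 1 = (gaussianReal 0 1).withDensity
      fun x => ENNReal.ofReal (Real.exp (m * x - m ^ 2 / 2)) := by
  rw [gaussianReal_eq_withDensity_exp m 0 one_ne_zero one_ne_zero]
  congr 1
  ext x
  congr 2
  rw [div_self (NNReal.coe_ne_zero.2 one_ne_zero), Real.log_one, NNReal.coe_one]
  ring

theorem gaussianReal_eq_withDensity_scale {v : ℝ} (hv : 0 < v) :
    gaussianReal 0 1 = (gaussianReal 0 v.toNNReal).withDensity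
      fun x => ENNReal.ofReal (Real.exp (Real.log v / 2 - (1 - 1 / v) / 2 * x ^ 2)) := by
  rw [gaussianReal_eq_withDensity_exp 0 0 one_ne_zero (Real.toNNReal_pos.2 hv).ne']
  congr 1
  ext x
  congr 2
  rw [Real.coe_toNNReal _ hv.le, NNReal.coe_one, div_one]
  ring

theorem lintegral_exp_shift_gaussianReal (m α : ℝ) :
    ∫⁻ x, ENNReal.ofReal (Real.exp (α * (m * x - m ^ 2 / 2))) ∂gaussianReal m 1
      = ENNReal.ofReal (Real.exp ((α + α ^ 2) / 2 * m ^ 2)) := by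
  have hsplit : ∀ x : ℝ, Real.exp (α * (m * x - m ^ 2 / 2))
      = Real.exp (α * m * x) * Real.exp (-(α * m ^ 2 / 2)) := fun x => by
    rw [← Real.exp_add]
    congr 1
    ring
  have hmgf : ∫ x, Real.exp (α * m * x) ∂gaussianReal m 1
      = Real.exp (m * (α * m) + (1 : NNReal) * (α * m) ^ 2 / 2) :=
    congrFun (mgf_fun_id_gaussianReal (μ := m) (v := 1)) (α * m)
  simp_rw [hsplit]
  rw [← ofReal_integral_eq_lintegral_ofReal ((integrable_exp_mul_gaussianReal _).mul_const _)
    (Filter.Eventually.of_forall fun _ => by positivity), integral_mul_const, hmgf, ← Real.exp_add,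
    NNReal.coe_one]
  congr 2
  ring

theorem lintegral_exp_neg_sq_gaussianReal {s : ℝ} (hs : 0 < 1 + s) :
    ∫⁻ x, ENNReal.ofReal (Real.exp (-(s / 2 * x ^ 2))) ∂gaussianReal 0 1
      = ENNReal.ofReal (Real.exp (-Real.log (1 + s) / 2)) := by
  -- Relative to `N(0, (1 + s)⁻¹)`, the integrand times the density of `N(0, 1)` is constant.
  have hconst : ∀ x : ℝ, ((fun x : ℝ => ENNReal.ofReal (Real.exp (Real.log (1 + s)⁻¹ / 2
        - (1 - 1 / (1 + s)⁻¹) / 2 * x ^ 2)))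
      * fun x : ℝ => ENNReal.ofReal (Real.exp (-(s / 2 * x ^ 2)))) x
      = ENNReal.ofReal (Real.exp (-Real.log (1 + s) / 2)) := fun x => by
    rw [Pi.mul_apply, ← ofReal_exp_add, Real.log_inv]
    congr 2
    field_simp
    ring
  conv_lhs => rw [gaussianReal_eq_withDensity_scale (inv_pos.2 hs)]
  rw [lintegral_withDensity_eq_lintegral_mul _ (by fun_prop) (by fun_prop)]
  simp_rw [hconst]
  rw [lintegral_const, measure_univ, mul_one]

theorem neg_sub_two_mul_sq_le_log_one_sub {z : ℝ} (hz : |z| ≤ 1 / 2) :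
    -z - 2 * z ^ 2 ≤ Real.log (1 - z) := by
  have hz' := abs_le.1 hz
  have hpos : 0 < 1 - z := by linarith
  refine le_trans ?_ (Real.one_sub_inv_le_log_of_pos hpos)
  have hdiff : 1 - (1 - z)⁻¹ - (-z - 2 * z ^ 2) = z ^ 2 * (1 - 2 * z) / (1 - z) := by
    field_simp
    ring
  have hnonneg : 0 ≤ z ^ 2 * (1 - 2 * z) / (1 - z) :=
    div_nonneg (mul_nonneg (sq_nonneg _) (by linarith)) hpos.le
  linarith

theorem lintegral_exp_scale_gaussianReal_le {v α : ℝ} (hα : 1 ≤ α)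
    (h : α * |1 - 1 / v| ≤ 1 / 2) :
    ∫⁻ x, ENNReal.ofReal (Real.exp (α * (Real.log v / 2 - (1 - 1 / v) / 2 * x ^ 2)))
        ∂gaussianReal 0 1
      ≤ ENNReal.ofReal (Real.exp (2 * (α * |1 - 1 / v|) ^ 2)) := by
  set u := 1 - 1 / v with hu
  have hαu : |α * u| ≤ 1 / 2 := by rwa [abs_mul, abs_of_pos (by linarith)]
  have hlogv : Real.log v = -Real.log (1 - u) := by
    rw [hu, sub_sub_cancel, one_div, Real.log_inv, neg_neg]
  have hsplit : ∀ x : ℝ, ENNReal.ofReal (Real.exp (α * (Real.log v / 2 - u / 2 * x ^ 2)))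
      = ENNReal.ofReal (Real.exp (α * (Real.log v / 2)))
        * ENNReal.ofReal (Real.exp (-(α * u / 2 * x ^ 2))) := fun x => by
    rw [← ofReal_exp_add]
    congr 2
    ring
  simp_rw [hsplit]
  rw [lintegral_const_mul _ (by fun_prop),
    lintegral_exp_neg_sq_gaussianReal (by linarith [(abs_le.1 hαu).1]), ← ofReal_exp_add]
  refine ENNReal.ofReal_le_ofReal (Real.exp_le_exp.2 ?_)
  have hlog_u := mul_le_mul_of_nonneg_left (neg_sub_two_mul_sq_le_log_one_sub
    ((le_mul_of_one_le_left (abs_nonneg u) hα).trans h)) (by linarith : 0 ≤ α)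
  have hlog_αu := neg_sub_two_mul_sq_le_log_one_sub (z := -(α * u)) (by rwa [abs_neg])
  have hsq : α * u ^ 2 ≤ α ^ 2 * u ^ 2 :=
    mul_le_mul_of_nonneg_right (le_self_pow₀ hα two_ne_zero) (sq_nonneg u)
  rw [sub_neg_eq_add] at hlog_αu
  rw [hlogv, mul_pow, sq_abs]
  linarith

theorem exp_sub_log_one_div (a : ℝ) {δ : ℝ} (hδ : 0 < δ) :
    Real.exp (a - Real.log (1 / δ)) = Real.exp a * δ := by
  rw [Real.exp_sub, Real.exp_log (one_div_pos.2 hδ), one_div, div_inv_eq_mul]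

section PiGaussian

variable {ι : Type*} [Fintype ι] {α ε δ : ℝ}

theorem maxDivergenceLE_pi_gaussianReal_shift (m : ι → ℝ) (hα : 0 < α) (hδ : 0 < δ)
    (h : (α + α ^ 2) / 2 * ∑ i, m i ^ 2 ≤ α * ε - Real.log (1 / δ)) :
    MaxDivergenceLE ε δ (Measure.pi fun i => gaussianReal (m i) 1)
      (Measure.pi fun _ : ι => gaussianReal 0 1) := by
  refine MaxDivergenceLE.pi_of_moment (g := fun i x => m i * x - m i ^ 2 / 2)
    (fun i => by fun_prop) (fun i => gaussianReal_eq_withDensity_shift (m i)) hα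
    (fun i => (α + α ^ 2) / 2 * m i ^ 2)
    (fun i => (lintegral_exp_shift_gaussianReal (m i) α).le) ?_
  rw [← Finset.mul_sum, ← exp_sub_log_one_div _ hδ]
  exact Real.exp_le_exp.2 h

theorem maxDivergenceLE_pi_gaussianReal_scale {v : ι → ℝ} (hv : ∀ i, 0 < v i) (hα : 1 ≤ α)
    (hδ : 0 < δ) (hsmall : α * ∑ i, |1 - 1 / v i| ≤ 1 / 2)
    (h : 2 * (α * ∑ i, |1 - 1 / v i|) ^ 2 ≤ α * ε - Real.log (1 / δ)) :
    MaxDivergenceLE ε δ (Measure.pi fun _ : ι => gaussianReal 0 1)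
      (Measure.pi fun i => gaussianReal 0 (v i).toNNReal) := by
  have hα0 : 0 < α := one_pos.trans_le hα
  have hle : ∀ i, |1 - 1 / v i| ≤ ∑ i, |1 - 1 / v i| := fun i =>
    Finset.single_le_sum (f := fun i => |1 - 1 / v i|) (fun _ _ => abs_nonneg _)
      (Finset.mem_univ i)
  refine MaxDivergenceLE.pi_of_moment
    (g := fun i x => Real.log (v i) / 2 - (1 - 1 / v i) / 2 * x ^ 2) (fun i => by fun_prop)
    (fun i => gaussianReal_eq_withDensity_scale (hv i)) hα0
    (fun i => 2 * (α * |1 - 1 / v i|) ^ 2)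
    (fun i => lintegral_exp_scale_gaussianReal_le hα
      ((mul_le_mul_of_nonneg_left (hle i) hα0.le).trans hsmall)) ?_
  rw [← exp_sub_log_one_div _ hδ]
  refine Real.exp_le_exp.2 (le_trans ?_ h)
  rw [← Finset.mul_sum, Finset.mul_sum Finset.univ _ α]
  gcongr
  exact Finset.sum_sq_le_sq_sum_of_nonneg fun i _ => by positivity

end PiGaussian

/-! ### Positive definite matrices and the Mahalanobis norm -/

section Matrix

open Matrix

variable {ι : Type*} [Fintype ι] [DecidableEq ι]

open scoped MatrixOrder in
theorem exists_isSymm_mul_self_eq {S : Matrix ι ι ℝ} (hS : S.PosDef) :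
    ∃ R : Matrix ι ι ℝ, IsUnit R ∧ R.IsSymm ∧ R * R = S := by
  have hRR : CFC.sqrt S * CFC.sqrt S = S := CFC.sqrt_mul_sqrt_self S hS.posSemidef.nonneg
  have hsymm := (nonneg_iff_posSemidef.1 (CFC.sqrt_nonneg S)).isHermitian.eq
  rw [conjTranspose_eq_transpose_of_trivial] at hsymm
  exact ⟨CFC.sqrt S, isUnit_of_mul_isUnit_left (hRR ▸ hS.isUnit), hsymm, hRR⟩

theorem exists_orthogonal_diagonalization {W : Matrix ι ι ℝ} (hW : W.PosDef) :
    ∃ (U : Matrix ι ι ℝ) (D : ι → ℝ), U * Uᵀ = 1 ∧ (∀ i, 0 < D i) ∧ U * diagonal D * Uᵀ = W := by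
  refine ⟨hW.isHermitian.eigenvectorUnitary.1, hW.isHermitian.eigenvalues, ?_,
    hW.eigenvalues_pos, ?_⟩
  · simpa [star_eq_conjTranspose] using
      Unitary.coe_mul_star_self hW.isHermitian.eigenvectorUnitary
  · have hspec := hW.isHermitian.spectral_theorem
    rw [Unitary.conjStarAlgAut_apply] at hspec
    simpa [star_eq_conjTranspose] using hspec.symm

theorem exists_simultaneous_diagonalization {S T : Matrix ι ι ℝ} (hS : S.PosDef) (hT : T.PosDef) :
    ∃ (A : Matrix ι ι ℝ) (D : ι → ℝ), IsUnit A ∧ (∀ i, 0 < D i) ∧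
      A * Aᵀ = S ∧ A * diagonal D * Aᵀ = T := by
  obtain ⟨R, hR, hRt, hRR⟩ := exists_isSymm_mul_self_eq hS
  have hRd := (isUnit_iff_isUnit_det R).1 hR
  have hRinv : (R⁻¹)ᵀ = R⁻¹ := by rw [transpose_nonsing_inv, hRt.eq]
  have hW : (R⁻¹ * T * R⁻¹).PosDef := by
    have hpsd := hT.posSemidef.mul_mul_conjTranspose_same R⁻¹
    rw [conjTranspose_eq_transpose_of_trivial, hRinv] at hpsd
    have hRinv_unit : IsUnit R⁻¹ := (isUnit_nonsing_inv_iff).2 hR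
    exact hpsd.posDef_iff_isUnit.2 ((hRinv_unit.mul hT.isUnit).mul hRinv_unit)
  obtain ⟨U, D, hU, hD, hUD⟩ := exists_orthogonal_diagonalization hW
  refine ⟨R * U, D, hR.mul (IsUnit.of_mul_eq_one _ hU), hD, ?_, ?_⟩
  · rw [transpose_mul, hRt.eq, Matrix.mul_assoc, ← Matrix.mul_assoc U, hU, Matrix.one_mul, hRR]
  · calc R * U * diagonal D * (R * U)ᵀ = R * (U * diagonal D * Uᵀ) * R := by
          rw [transpose_mul, hRt.eq]; simp only [Matrix.mul_assoc]
      _ = R * R⁻¹ * T * (R⁻¹ * R) := by rw [hUD]; simp only [Matrix.mul_assoc]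
      _ = T := by rw [mul_nonsing_inv _ hRd, nonsing_inv_mul _ hRd, Matrix.one_mul, Matrix.mul_one]

variable {d : ℕ}

theorem mahalanobisSq_mul_diagonal_mul_transpose {A : Matrix (Fin d) (Fin d) ℝ} {D : Fin d → ℝ}
    (hD : ∀ i, D i ≠ 0) (v : EuclideanSpace ℝ (Fin d)) :
    mahalanobisSq (A * diagonal D * Aᵀ) v = ∑ i, A⁻¹.toEuclideanLin v i ^ 2 / D i := by
  have hDinv : (diagonal D)⁻¹ = diagonal fun i => (D i)⁻¹ :=
    inv_eq_right_inv <| by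
      rw [diagonal_mul_diagonal, ← diagonal_one]
      exact congrArg diagonal (funext fun i => mul_inv_cancel₀ (hD i))
  rw [mahalanobisSq, Matrix.mul_inv_rev, Matrix.mul_inv_rev, hDinv, ← transpose_nonsing_inv,
    ← mulVec_mulVec, ← mulVec_mulVec, dotProduct_mulVec, ← mulVec_transpose, transpose_transpose]
  simp only [dotProduct, mulVec_diagonal, toLpLin_apply]
  exact Finset.sum_congr rfl fun i _ => by ring

theorem mahalanobisSq_mul_transpose (A : Matrix (Fin d) (Fin d) ℝ)
    (v : EuclideanSpace ℝ (Fin d)) :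
    mahalanobisSq (A * Aᵀ) v = ‖A⁻¹.toEuclideanLin v‖ ^ 2 := by
  have h := mahalanobisSq_mul_diagonal_mul_transpose (A := A) (D := 1) (fun _ => one_ne_zero) v
  simp only [Pi.one_apply, div_one] at h
  rwa [show diagonal (1 : Fin d → ℝ) = 1 from diagonal_one, Matrix.mul_one,
    ← EuclideanSpace.real_norm_sq_eq] at h

theorem mahalanobisSq_smul {c : ℝ} (hc : c ≠ 0) {S : Matrix (Fin d) (Fin d) ℝ} (hS : IsUnit S)
    (v : EuclideanSpace ℝ (Fin d)) : mahalanobisSq (c • S) v = c⁻¹ * mahalanobisSq S v := by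
  have := invertibleOfNonzero hc
  rw [mahalanobisSq, mahalanobisSq, Matrix.inv_smul S c ((isUnit_iff_isUnit_det S).1 hS),
    smul_mulVec, dotProduct_smul, smul_eq_mul, invOf_eq_inv]

theorem mahalanobisSq_sub_le {S : Matrix (Fin d) (Fin d) ℝ} (hS : S.PosSemidef)
    (u v : EuclideanSpace ℝ (Fin d)) :
    mahalanobisSq S (u - v) ≤ 2 * mahalanobisSq S u + 2 * mahalanobisSq S v := by
  have hnonneg : 0 ≤ mahalanobisSq S (u + v) := hS.inv.dotProduct_mulVec_nonneg _
  have hparallelogram : mahalanobisSq S (u - v) + mahalanobisSq S (u + v)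
      = 2 * mahalanobisSq S u + 2 * mahalanobisSq S v := by
    simp only [mahalanobisSq, WithLp.ofLp_sub, WithLp.ofLp_add, mulVec_sub, mulVec_add,
      dotProduct_sub, dotProduct_add, sub_dotProduct, add_dotProduct]
    ring
  linarith

theorem mahalanobisSq_mul_transpose_le {A : Matrix (Fin d) (Fin d) ℝ} {D : Fin d → ℝ} {M : ℝ}
    (hD : ∀ i, 0 < D i) (hM : ∀ i, D i ≤ M) (v : EuclideanSpace ℝ (Fin d)) :
    mahalanobisSq (A * Aᵀ) v ≤ M * mahalanobisSq (A * diagonal D * Aᵀ) v := by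
  rw [mahalanobisSq_mul_transpose, mahalanobisSq_mul_diagonal_mul_transpose fun i => (hD i).ne',
    EuclideanSpace.real_norm_sq_eq, Finset.mul_sum]
  refine Finset.sum_le_sum fun i _ => ?_
  rw [← mul_div_assoc, le_div_iff₀ (hD i), mul_comm]
  exact mul_le_mul_of_nonneg_right (hM i) (sq_nonneg _)

end Matrix

/-! ### Privacy loss between multivariate Gaussian measures -/

section MultivariateGaussian

open Matrix

variable {ι : Type*} [Fintype ι] [DecidableEq ι]

theorem map_affine_multivariateGaussian {κ : Type*} [Fintype κ] [DecidableEq κ]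
    (b : EuclideanSpace ℝ κ) (A : Matrix κ ι ℝ) (μ : EuclideanSpace ℝ ι) {S : Matrix ι ι ℝ}
    (hS : S.PosSemidef) :
    (multivariateGaussian μ S).map (fun x => b + A.toEuclideanLin x)
      = multivariateGaussian (b + A.toEuclideanLin μ) (A * S * Aᵀ) := by
  have hmeas : Measurable fun x : EuclideanSpace ℝ ι => b + A.toEuclideanLin x := by fun_prop
  have := Measure.isProbabilityMeasure_map (μ := multivariateGaussian μ S) hmeas.aemeasurable
  have hadj : ∀ x t, inner ℝ (A.toEuclideanLin x) t = inner ℝ x (Aᵀ.toEuclideanLin t) :=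
    fun x t => by
      rw [← conjTranspose_eq_transpose_of_trivial, toEuclideanLin_conjTranspose_eq_adjoint,
        LinearMap.adjoint_inner_right]
  have hASA : (A * S * Aᵀ).PosSemidef := hS.mul_mul_conjTranspose_same A
  refine Measure.ext_of_charFun (funext fun t => ?_)
  have hquad : t.ofLp ⬝ᵥ (A * S * Aᵀ) *ᵥ t.ofLp
      = (Aᵀ.toEuclideanLin t).ofLp ⬝ᵥ S *ᵥ (Aᵀ.toEuclideanLin t).ofLp := by
    rw [← mulVec_mulVec, ← mulVec_mulVec, dotProduct_mulVec, ← mulVec_transpose]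
    rfl
  calc charFun ((multivariateGaussian μ S).map fun x => b + A.toEuclideanLin x) t
      = ∫ x, Complex.exp (inner ℝ x (Aᵀ.toEuclideanLin t) * Complex.I)
          * Complex.exp (inner ℝ b t * Complex.I) ∂multivariateGaussian μ S := by
        rw [charFun_apply, integral_map hmeas.aemeasurable (by fun_prop)]
        simp only [inner_add_left, hadj, Complex.ofReal_add, add_mul, ← Complex.exp_add, add_comm]
    _ = charFun (multivariateGaussian μ S) (Aᵀ.toEuclideanLin t)
          * Complex.exp (inner ℝ b t * Complex.I) := by rw [integral_mul_const, charFun_apply]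
    _ = charFun (multivariateGaussian (b + A.toEuclideanLin μ) (A * S * Aᵀ)) t := by
        rw [charFun_multivariateGaussian hS, charFun_multivariateGaussian hASA, hquad,
          ← Complex.exp_add, inner_add_right, ← real_inner_comm t (A.toEuclideanLin μ), hadj,
          ← real_inner_comm t b, real_inner_comm]
        push_cast
        ring_nf

theorem map_toLp_pi_gaussianReal (m : ι → ℝ) {v : ι → ℝ} (hv : ∀ i, 0 ≤ v i) :
    (Measure.pi fun i => gaussianReal (m i) (v i).toNNReal).map (WithLp.toLp 2)
      = multivariateGaussian (WithLp.toLp 2 m) (diagonal v) := by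
  have := Measure.isProbabilityMeasure_map
    (μ := Measure.pi fun i => gaussianReal (m i) (v i).toNNReal)
    (f := WithLp.toLp 2) (by fun_prop)
  refine Measure.ext_of_charFun (funext fun t => ?_)
  rw [charFun_pi, charFun_multivariateGaussian (posSemidef_diagonal_iff.2 hv), PiLp.inner_apply]
  simp only [charFun_gaussianReal, ← Complex.exp_sum, Finset.sum_sub_distrib, dotProduct,
    mulVec_diagonal, Complex.ofReal_sum, Finset.sum_mul, Finset.sum_div, RCLike.inner_apply,
    conj_trivial, Real.coe_toNNReal _ (hv _)]
  congr 2
  · exact Finset.sum_congr rfl fun i _ => by push_cast; ring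
  · exact Finset.sum_congr rfl fun i _ => by push_cast; ring

theorem map_affine_pi_gaussianReal (b : EuclideanSpace ℝ ι) (A : Matrix ι ι ℝ) (m : ι → ℝ)
    {v : ι → ℝ} (hv : ∀ i, 0 ≤ v i) :
    (Measure.pi fun i => gaussianReal (m i) (v i).toNNReal).map
        (fun x => b + A.toEuclideanLin (WithLp.toLp 2 x))
      = multivariateGaussian (b + A.toEuclideanLin (WithLp.toLp 2 m)) (A * diagonal v * Aᵀ) := by
  rw [← map_affine_multivariateGaussian b A _ (posSemidef_diagonal_iff.2 hv),
    ← map_toLp_pi_gaussianReal m hv, Measure.map_map (by fun_prop) (by fun_prop)]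
  rfl

theorem map_affine_pi_gaussianReal_one (b : EuclideanSpace ℝ ι) (A : Matrix ι ι ℝ) (m : ι → ℝ) :
    (Measure.pi fun i => gaussianReal (m i) 1).map
        (fun x => b + A.toEuclideanLin (WithLp.toLp 2 x))
      = multivariateGaussian (b + A.toEuclideanLin (WithLp.toLp 2 m)) (A * Aᵀ) := by
  have h := map_affine_pi_gaussianReal b A m (v := 1) fun _ => zero_le_one
  simp only [Pi.one_apply, Real.toNNReal_one] at h
  rwa [show diagonal (1 : ι → ℝ) = 1 from diagonal_one, Matrix.mul_one] at h

variable {α ε δ : ℝ}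

theorem maxDivergenceLE_multivariateGaussian_mean {d : ℕ} {S : Matrix (Fin d) (Fin d) ℝ}
    (hS : S.PosDef) (μ₁ μ₂ : EuclideanSpace ℝ (Fin d)) (hα : 0 < α) (hδ : 0 < δ)
    (h : (α + α ^ 2) / 2 * mahalanobisSq S (μ₁ - μ₂) ≤ α * ε - Real.log (1 / δ)) :
    MaxDivergenceLE ε δ (multivariateGaussian μ₁ S) (multivariateGaussian μ₂ S) := by
  obtain ⟨R, hR, hRt, hRR⟩ := exists_isSymm_mul_self_eq hS
  obtain rfl : R * Rᵀ = S := by rw [hRt.eq, hRR]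
  rw [mahalanobisSq_mul_transpose, EuclideanSpace.real_norm_sq_eq] at h
  have hmap := (maxDivergenceLE_pi_gaussianReal_shift _ hα hδ h).map
    (f := fun x => μ₂ + R.toEuclideanLin (WithLp.toLp 2 x)) (by fun_prop)
  have hshift := map_affine_pi_gaussianReal_one μ₂ R (R⁻¹.toEuclideanLin (μ₁ - μ₂)).ofLp
  have hstd := map_affine_pi_gaussianReal_one μ₂ R 0
  have hRinv : R.toEuclideanLin (R⁻¹.toEuclideanLin (μ₁ - μ₂)) = μ₁ - μ₂ := by
    rw [← LinearMap.comp_apply, ← toLpLin_mul_same,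
      mul_nonsing_inv _ ((isUnit_iff_isUnit_det R).1 hR), toLpLin_one, LinearMap.id_apply]
  simp only [Pi.zero_apply, WithLp.toLp_zero, map_zero, add_zero] at hstd
  rw [WithLp.toLp_ofLp, hRinv, add_sub_cancel] at hshift
  rwa [hshift, hstd] at hmap

theorem maxDivergenceLE_multivariateGaussian_cov (μ : EuclideanSpace ℝ ι) (A : Matrix ι ι ℝ)
    {D : ι → ℝ} (hD : ∀ i, 0 < D i) (hα : 1 ≤ α) (hδ : 0 < δ)
    (hsmall : α * ∑ i, |1 - 1 / D i| ≤ 1 / 2)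
    (h : 2 * (α * ∑ i, |1 - 1 / D i|) ^ 2 ≤ α * ε - Real.log (1 / δ)) :
    MaxDivergenceLE ε δ (multivariateGaussian μ (A * Aᵀ))
      (multivariateGaussian μ (A * diagonal D * Aᵀ)) := by
  have hmap := (maxDivergenceLE_pi_gaussianReal_scale hD hα hδ hsmall h).map
    (f := fun x => μ + A.toEuclideanLin (WithLp.toLp 2 x)) (by fun_prop)
  have hstd := map_affine_pi_gaussianReal_one μ A 0
  have hscaled := map_affine_pi_gaussianReal μ A 0 fun i => (hD i).le
  simp only [Pi.zero_apply, WithLp.toLp_zero, map_zero, add_zero] at hstd hscaled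
  rwa [hstd, hscaled] at hmap

end MultivariateGaussian

/-! ### Tails and translations of the Laplace distribution -/

section Laplace

variable {b : ℝ}

theorem laplace_density_le (hb : 0 < b) {c r r' : ℝ} (h : |r'| ≤ |r| + b * c) :
    ENNReal.ofReal (Real.exp (-|r| / b) / (2 * b))
      ≤ ENNReal.ofReal (Real.exp c) * ENNReal.ofReal (Real.exp (-|r'| / b) / (2 * b)) := by
  rw [← ENNReal.ofReal_mul (Real.exp_nonneg _), ← mul_div_assoc, ← Real.exp_add]
  gcongr
  rw [div_le_iff₀ hb, add_mul, div_mul_cancel₀ _ hb.ne']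
  linarith

theorem laplace_preimage_add_le (hb : 0 < b) {c v : ℝ} {B : Set ℝ} (hB : MeasurableSet B)
    (h : ∀ r, r + v ∈ B → |r + v| ≤ |r| + b * c) :
    laplace b ((· + v) ⁻¹' B) ≤ ENNReal.ofReal (Real.exp c) * laplace b B := by
  have hA : MeasurableSet ((· + v) ⁻¹' B) := measurable_add_const v hB
  have hdensity : Measurable fun r : ℝ => ENNReal.ofReal (Real.exp (-|r| / b) / (2 * b)) := by
    fun_prop
  rw [laplace, withDensity_apply _ hA, withDensity_apply _ hB, ← lintegral_indicator hA,
    ← lintegral_indicator hB, ← lintegral_add_right_eq_self (B.indicator _) v,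
    ← lintegral_const_mul _ (by have := hdensity.indicator hB; fun_prop)]
  refine lintegral_mono fun r => ?_
  by_cases hr : r + v ∈ B
  · rw [Set.indicator_of_mem (show r ∈ (· + v) ⁻¹' B from hr), Set.indicator_of_mem hr]
    exact laplace_density_le hb (h r hr)
  · rw [Set.indicator_of_notMem (show r ∉ (· + v) ⁻¹' B from hr)]
    exact zero_le

theorem laplace_preimage_add_le_of_abs_le (hb : 0 < b) {c v : ℝ} (hv : |v| ≤ b * c) {B : Set ℝ}
    (hB : MeasurableSet B) :
    laplace b ((· + v) ⁻¹' B) ≤ ENNReal.ofReal (Real.exp c) * laplace b B :=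
  laplace_preimage_add_le hb hB fun r _ => (abs_add_le r v).trans (by gcongr)

theorem laplace_Iic_le (hb : 0 < b) {a a' c : ℝ} (h : |a' - a| ≤ b * c) :
    laplace b (Set.Iic a) ≤ ENNReal.ofReal (Real.exp c) * laplace b (Set.Iic a') := by
  simpa only [Set.preimage_add_const_Iic, sub_sub_cancel] using
    laplace_preimage_add_le_of_abs_le hb h (measurableSet_Iic (a := a'))

theorem laplace_Ioi_le (hb : 0 < b) {a a' c : ℝ} (h : |a' - a| ≤ b * c) :
    laplace b (Set.Ioi a) ≤ ENNReal.ofReal (Real.exp c) * laplace b (Set.Ioi a') := by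
  simpa only [Set.preimage_add_const_Ioi, sub_sub_cancel] using
    laplace_preimage_add_le_of_abs_le hb h (measurableSet_Ioi (a := a'))

theorem laplace_Iic_neg_le (hb : 0 < b) {s : ℝ} (hs : 0 ≤ s) :
    laplace b (Set.Iic (-s)) ≤ ENNReal.ofReal (Real.exp (-(s / b))) := by
  have := isProbabilityMeasure_laplace hb
  have h : laplace b (Set.Iic (-s))
      ≤ ENNReal.ofReal (Real.exp (-(s / b))) * laplace b (Set.Iic 0) := by
    rw [← zero_sub s, ← Set.preimage_add_const_Iic]
    refine laplace_preimage_add_le hb measurableSet_Iic fun r (hr : r + s ≤ 0) => ?_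
    rw [abs_of_nonpos hr, abs_of_nonpos (by linarith), mul_neg, mul_div_cancel₀ _ hb.ne']
    linarith
  exact h.trans (mul_le_of_le_one_right zero_le prob_le_one)

theorem laplace_Iic_le_ofReal (hb : 0 < b) {a δ : ℝ} (hδ : 0 < δ) (hδ1 : δ ≤ 1)
    (ha : a ≤ -(b * Real.log (1 / δ))) : laplace b (Set.Iic a) ≤ ENNReal.ofReal δ := by
  have hlog : 0 ≤ Real.log (1 / δ) := Real.log_nonneg (one_le_one_div hδ hδ1)
  refine (measure_mono (Set.Iic_subset_Iic.2 ha)).trans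
    ((laplace_Iic_neg_le hb (by positivity)).trans_eq ?_)
  rw [mul_div_cancel_left₀ _ hb.ne', one_div, Real.log_inv, neg_neg, Real.exp_log hδ]

end Laplace

/-! ### The Hamming distance -/

section Hamming

variable {m d : ℕ}

theorem dataDist_comm (x y : DataSet m d) : dataDist x y = dataDist y x :=
  hammingDist_comm x y

theorem dataDist_triangle (x y z : DataSet m d) : dataDist x z ≤ dataDist x y + dataDist y z :=
  hammingDist_triangle x y z

open Classical in
theorem exists_finset_eqOn_compl (x y : DataSet m d) :
    ∃ T : Finset (Fin m), T.card = dataDist x y ∧ ∀ i ∉ T, x i = y i :=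
  ⟨Finset.univ.filter fun i => x i ≠ y i, rfl, fun i hi => by simpa using hi⟩

theorem dataDist_le_of_injective {m' : ℕ} {x y : DataSet m d} {x' y' : DataSet m' d}
    {f : Fin m → Fin m'} (hf : f.Injective) (h : ∀ i, x i ≠ y i → x' (f i) ≠ y' (f i)) :
    dataDist x y ≤ dataDist x' y' := by
  unfold dataDist hammingDist
  exact Finset.card_le_card_of_injOn f (by simpa [Set.MapsTo] using h) hf.injOn

theorem dataDist_comp_perm (x y : DataSet m d) (σ : Equiv.Perm (Fin m)) :
    dataDist (x ∘ σ) (y ∘ σ) = dataDist x y :=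
  le_antisymm (dataDist_le_of_injective σ.injective fun _ h => h)
    (dataDist_le_of_injective σ.symm.injective fun i h => by simpa using h)

variable {n : ℕ}

theorem dataDist_pairDiff_le (z w : DataSet (3 * n) d) :
    dataDist (pairDiff z) (pairDiff w) ≤ dataDist z w := by
  classical
  refine dataDist_le_of_injective (f := fun j => if z ⟨j, by omega⟩ ≠ w ⟨j, by omega⟩
    then ⟨j, by omega⟩ else ⟨j + n, by omega⟩) (fun i j hij => ?_) fun j hj => ?_
  · ext
    dsimp only at hij
    split_ifs at hij <;> simp only [Fin.mk.injEq] at hij <;> omega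
  · split_ifs with h
    · exact h
    · exact fun h' => hj (by rw [pairDiff, pairDiff, not_not.1 h, h'])

/-- The last third of a data set, from which the empirical mean is computed. -/
def meanRecords (x : DataSet (3 * n) d) : DataSet n d := fun i => x ⟨i + 2 * n, by omega⟩

theorem dataDist_meanRecords_le (z w : DataSet (3 * n) d) :
    dataDist (meanRecords z) (meanRecords w) ≤ dataDist z w :=
  dataDist_le_of_injective (f := fun j => ⟨j + 2 * n, by omega⟩)
    (fun i j hij => by simpa [Fin.ext_iff] using hij) fun _ h => h

namespace IsProjection

variable {S : Set (DataSet m d)} {proj : DataSet m d → DataSet m d}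

theorem dataDistToSet_eq (h : IsProjection S proj) (hS : S.Nonempty) (x : DataSet m d) :
    dataDistToSet x S = dataDist x (proj x) :=
  le_antisymm (iInf₂_le _ (h hS x).1) (le_iInf₂ fun z hz => mod_cast (h hS x).2 z hz)

theorem dataDist_le (h : IsProjection S proj) (hS : S.Nonempty) (x y : DataSet m d) :
    dataDist x (proj x) ≤ dataDist x y + dataDist y (proj y) :=
  ((h hS x).2 _ (h hS y).1).trans (dataDist_triangle _ _ _)

end IsProjection

end Hamming

/-! ### The noisy distance test -/

open Classical in
theorem bind_ite_const {W W' : Type*} [MeasurableSpace W] [MeasurableSpace W'] (μ : Measure W)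
    {s : Set W} (hs : MeasurableSet s) (P Q : Measure W') :
    (μ.bind fun r => if r ∈ s then P else Q) = μ s • P + μ sᶜ • Q := by
  ext E hE
  have hmeas : Measurable fun r => if r ∈ s then P else Q :=
    Measurable.ite hs measurable_const measurable_const
  have happly : ∀ r, (if r ∈ s then P else Q) E
      = s.indicator (fun _ => P E) r + sᶜ.indicator (fun _ => Q E) r := fun r => by
    by_cases hr : r ∈ s <;> simp [hr]
  simp only [Measure.bind_apply hE hmeas.aemeasurable, happly, Measure.add_apply,
    Measure.smul_apply, smul_eq_mul]
  rw [lintegral_add_left (measurable_const.indicator hs), lintegral_indicator_const hs,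
    lintegral_indicator_const hs.compl, mul_comm, mul_comm (Q E)]

/-- If the noisy test passes with noticeable probability, then `h₁` and `h₂` exceed the threshold
`t` by at most `(1/ε) log (1/δ)`; only then do the released distributions have to be close. -/
theorem maxDivergenceLE_noisyTest {W : Type*} [MeasurableSpace W] {ε δ ε' δ' h₁ h₂ t : ℝ}
    (hε : 0 < ε) (hδ : 0 < δ) (hδ1 : δ ≤ 1) (hε' : 0 ≤ ε') (hδ' : δ ≤ δ') (hh : |h₁ - h₂| ≤ 1)
    {F G₁ G₂ : Measure W} [IsProbabilityMeasure G₁]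
    (hG : h₁ ≤ t + 1 / ε * Real.log (1 / δ) → h₂ ≤ t + 1 / ε * Real.log (1 / δ) →
      MaxDivergenceLE ε' δ' G₁ G₂) :
    MaxDivergenceLE (ε + ε') (Real.exp ε * δ')
      (laplace (1 / ε) (Set.Ioi (t - h₁)) • F + laplace (1 / ε) (Set.Iic (t - h₁)) • G₁)
      (laplace (1 / ε) (Set.Ioi (t - h₂)) • F + laplace (1 / ε) (Set.Iic (t - h₂)) • G₂) := by
  have hb : 0 < 1 / ε := one_div_pos.2 hε
  have := isProbabilityMeasure_laplace hb
  set s := 1 / ε * Real.log (1 / δ)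
  have hshift : |t - h₂ - (t - h₁)| ≤ 1 / ε * ε := by
    rwa [sub_sub_sub_cancel_left, one_div_mul_cancel hε.ne']
  have hfail := laplace_Ioi_le hb hshift
  have hpass := laplace_Iic_le hb hshift
  have htail : ∀ h, t + s < h → laplace (1 / ε) (Set.Iic (t - h)) ≤ ENNReal.ofReal δ' :=
    fun h hh => (laplace_Iic_le_ofReal hb hδ hδ1 (by linarith)).trans
      (ENNReal.ofReal_le_ofReal hδ')
  by_cases hclose : h₁ ≤ t + s ∧ h₂ ≤ t + s
  · exact .mixture hfail hpass prob_le_one hε' (hG hclose.1 hclose.2)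
  refine (MaxDivergenceLE.mixture_of_le hfail ?_).mono (le_add_of_nonneg_right hε') le_rfl
  rw [ENNReal.ofReal_mul (Real.exp_nonneg ε)]
  rcases not_and_or.1 hclose with h₁_far | h₂_far
  · exact (htail h₁ (not_le.1 h₁_far)).trans
      (le_mul_of_one_le_left zero_le (one_le_ofReal_exp hε.le))
  · exact hpass.trans (by gcongr; exact htail h₂ (not_le.1 h₂_far))

/-- The Gaussian distribution released when the projected data set is `z`. -/
noncomputable def releaseGaussian {n d : ℕ} (Csq : ℝ) (z : DataSet (3 * n) d) :
    Measure (EuclideanSpace ℝ (Fin d)) :=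
  multivariateGaussian (empMean z) (Csq • empCov z)

instance {n d : ℕ} (Csq : ℝ) (z : DataSet (3 * n) d) :
    IsProbabilityMeasure (releaseGaussian Csq z) :=
  inferInstanceAs (IsProbabilityMeasure (multivariateGaussian _ _))

theorem kParam_eq (ε : ℝ) {δ β : ℝ} (hδ : δ ≠ 0) (hβ : β ≠ 0) :
    kParam ε δ β = 2 * (tParam ε β + 1 / ε * Real.log (1 / δ)) + 1 := by
  rw [kParam, tParam, one_div (δ * β), mul_inv,
    Real.log_mul (inv_ne_zero hδ) (inv_ne_zero hβ), one_div β, one_div δ]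
  ring

section AfterPermutation

variable {n d : ℕ} {ε lam : ℝ} {proj : DataSet (3 * n) d → DataSet (3 * n) d}

theorem afterPermutation_of_goodSet_eq_empty (hε : 0 < ε) (t Csq : ℝ)
    (hS : goodSet n d lam = ∅) (x : DataSet (3 * n) d) :
    afterPermutation ε t lam Csq proj x = Measure.dirac outFail := by
  have := isProbabilityMeasure_laplace (one_div_pos.2 hε)
  simp only [afterPermutation, dataDistToSet, hS, Set.mem_empty_iff_false, iInf_false, iInf_top,
    true_or, if_true]
  rw [Measure.bind_const, measure_univ, one_smul]

theorem afterPermutation_eq_mixture (t Csq : ℝ) (hp : IsProjection (goodSet n d lam) proj)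
    (hS : (goodSet n d lam).Nonempty) (x : DataSet (3 * n) d) :
    afterPermutation ε t lam Csq proj x
      = laplace (1 / ε) (Set.Ioi (t - dataDist x (proj x))) • Measure.dirac outFail
        + laplace (1 / ε) (Set.Iic (t - dataDist x (proj x)))
          • (releaseGaussian Csq (proj x)).map Sum.inl := by
  rw [← Set.compl_Ioi, ← bind_ite_const _ measurableSet_Ioi, afterPermutation,
    hp.dataDistToSet_eq hS]
  simp only [ENat.natCast_ne_top, false_or, ENat.toNat_natCast, gt_iff_lt, Set.mem_Ioi,
    sub_lt_iff_lt_add', releaseGaussian]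

theorem abs_dataDist_proj_sub_le (hp : IsProjection (goodSet n d lam) proj)
    (hS : (goodSet n d lam).Nonempty) {x y : DataSet (3 * n) d} (hxy : Neighboring x y) :
    |(dataDist x (proj x) : ℝ) - dataDist y (proj y)| ≤ 1 := by
  have hxy' : dataDist x y ≤ 1 := hxy
  have hx : dataDist x (proj x) ≤ 1 + dataDist y (proj y) :=
    (hp.dataDist_le hS x y).trans (by gcongr)
  have hy : dataDist y (proj y) ≤ 1 + dataDist x (proj x) :=
    (hp.dataDist_le hS y x).trans (by rw [dataDist_comm]; gcongr)
  rify at hx hy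
  rw [abs_le]
  constructor <;> linarith

theorem dataDist_proj_le {x y : DataSet (3 * n) d} (hxy : Neighboring x y) :
    dataDist (proj x) (proj y) ≤ dataDist x (proj x) + dataDist y (proj y) + 1 := by
  have hxy' : dataDist x y ≤ 1 := hxy
  have h₁ := dataDist_triangle (proj x) x (proj y)
  have h₂ := dataDist_triangle x y (proj y)
  rw [dataDist_comm (proj x) x] at h₁
  omega

theorem maxDivergenceLE_afterPermutation {δ β Csq ε' δ' : ℝ} (hε : 0 < ε) (hδ : 0 < δ)
    (hδ1 : δ ≤ 1) (hβ : 0 < β) (hε' : 0 ≤ ε') (hδ' : δ ≤ δ')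
    (hp : IsProjection (goodSet n d lam) proj)
    (hG : ∀ z ∈ goodSet n d lam, ∀ w ∈ goodSet n d lam, dataDist z w ≤ kParam ε δ β →
      MaxDivergenceLE ε' δ' (releaseGaussian Csq z) (releaseGaussian Csq w))
    {x y : DataSet (3 * n) d} (hxy : Neighboring x y) :
    MaxDivergenceLE (ε + ε') (Real.exp ε * δ') (afterPermutation ε (tParam ε β) lam Csq proj x)
      (afterPermutation ε (tParam ε β) lam Csq proj y) := by
  rcases (goodSet n d lam).eq_empty_or_nonempty with hS | hS
  · rw [afterPermutation_of_goodSet_eq_empty hε _ _ hS,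
      afterPermutation_of_goodSet_eq_empty hε _ _ hS]
    exact .refl (by linarith) _
  have : IsProbabilityMeasure
      ((releaseGaussian Csq (proj x)).map (Sum.inl : _ → Output d)) :=
    Measure.isProbabilityMeasure_map measurable_inl.aemeasurable
  rw [afterPermutation_eq_mixture _ _ hp hS, afterPermutation_eq_mixture _ _ hp hS]
  refine maxDivergenceLE_noisyTest hε hδ hδ1 hε' hδ' (abs_dataDist_proj_sub_le hp hS hxy)
    fun hx hy => (hG _ (hp hS x).1 _ (hp hS y).1 ?_).map measurable_inl
  have hdist : (dataDist (proj x) (proj y) : ℝ)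
      ≤ dataDist x (proj x) + dataDist y (proj y) + 1 := by
    exact_mod_cast dataDist_proj_le hxy
  rw [kParam_eq ε hδ.ne' hβ.ne']
  linarith

end AfterPermutation

/-! ### Empirical means and covariances of good data sets -/

section Empirical

open Matrix

variable {n d : ℕ}

theorem empCov_posSemidef (x : DataSet (3 * n) d) : (empCov x).PosSemidef := by
  refine PosSemidef.smul (posSemidef_sum _ fun i _ => ?_) (by positivity)
  simpa using posSemidef_vecMulVec_self_star (pairDiff x i).ofLp

theorem empCov_posDef {x : DataSet (3 * n) d} (h : IsUnit (empCov x)) : (empCov x).PosDef :=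
  (empCov_posSemidef x).posDef_iff_isUnit.2 h

theorem mul_empCov_mul_transpose_apply (B : Matrix (Fin d) (Fin d) ℝ) (x : DataSet (3 * n) d)
    (i : Fin d) :
    (B * empCov x * Bᵀ) i i
      = 1 / (2 * (n : ℝ)) * ∑ j, B.toEuclideanLin (pairDiff x j) i ^ 2 := by
  simp only [empCov, Matrix.mul_smul, Matrix.smul_mul, Matrix.smul_apply, smul_eq_mul,
    Matrix.mul_sum, Matrix.sum_mul, Matrix.sum_apply, mul_vecMulVec, vecMulVec_mul, vecMulVec_apply,
    vecMul_transpose, toLpLin_apply, sq]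

theorem sum_sq_whitened_pairDiff {x : DataSet (3 * n) d} {A : Matrix (Fin d) (Fin d) ℝ}
    (hA : IsUnit A) {D : Fin d → ℝ} (hx : A * diagonal D * Aᵀ = empCov x) (i : Fin d) :
    1 / (2 * (n : ℝ)) * ∑ j, A⁻¹.toEuclideanLin (pairDiff x j) i ^ 2 = D i := by
  have hAinv : A⁻¹ * A = 1 := nonsing_inv_mul A ((isUnit_iff_isUnit_det A).1 hA)
  have hwhiten : A⁻¹ * empCov x * (A⁻¹)ᵀ = diagonal D := by
    calc A⁻¹ * empCov x * (A⁻¹)ᵀ = A⁻¹ * A * diagonal D * (A⁻¹ * A)ᵀ := by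
          rw [← hx, transpose_mul]; simp only [Matrix.mul_assoc]
      _ = diagonal D := by rw [hAinv, transpose_one, Matrix.one_mul, Matrix.mul_one]
  rw [← mul_empCov_mul_transpose_apply, hwhiten, diagonal_apply_eq]

theorem sum_mahalanobisSq_pairDiff {x : DataSet (3 * n) d} (h : IsUnit (empCov x)) :
    1 / (2 * (n : ℝ)) * ∑ j, mahalanobisSq (empCov x) (pairDiff x j) = d := by
  have htrace : ∀ v, mahalanobisSq (empCov x) v
      = trace ((empCov x)⁻¹ * vecMulVec v.ofLp v.ofLp) := fun v => by
    rw [mul_vecMulVec, trace_vecMulVec, mahalanobisSq, dotProduct_comm]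
  simp only [htrace]
  rw [← trace_sum, ← Matrix.mul_sum, ← smul_eq_mul, ← trace_smul, ← Matrix.mul_smul, ← empCov,
    nonsing_inv_mul _ ((isUnit_iff_isUnit_det _).1 h), trace_one, Fintype.card_fin]

variable {lam : ℝ} {x : DataSet (3 * n) d}

theorem mahalanobisSq_pairDiff_le (hx : x ∈ goodSet n d lam) (j : Fin n) :
    mahalanobisSq (empCov x) (pairDiff x j) ≤ 4 * lam := by
  have h₁ := hx.2 ⟨j, by omega⟩
  have h₂ := hx.2 ⟨j + n, by omega⟩
  have h := mahalanobisSq_sub_le (empCov_posSemidef x) (x ⟨j, by omega⟩ - empMean x)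
    (x ⟨j + n, by omega⟩ - empMean x)
  rw [sub_sub_sub_cancel_right, ← pairDiff] at h
  linarith

theorem pos_of_mem_goodSet (hx : x ∈ goodSet n d lam) (hd : 0 < d) : 0 < n := by
  refine Nat.pos_of_ne_zero fun hn => hd.ne ?_
  subst hn
  have h := sum_mahalanobisSq_pairDiff hx.1
  rw [Nat.cast_zero, mul_zero, div_zero, zero_mul] at h
  exact_mod_cast h

theorem dim_le_of_mem_goodSet (hx : x ∈ goodSet n d lam) (hn : 0 < n) : (d : ℝ) ≤ 2 * lam := by
  rify at hn
  calc (d : ℝ) = 1 / (2 * (n : ℝ)) * ∑ j, mahalanobisSq (empCov x) (pairDiff x j) :=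
        (sum_mahalanobisSq_pairDiff hx.1).symm
    _ ≤ 1 / (2 * (n : ℝ)) * ∑ _j : Fin n, 4 * lam := by
        gcongr with j
        exact mahalanobisSq_pairDiff_le hx j
    _ = 2 * lam := by
        rw [Finset.sum_const, Finset.card_univ, Fintype.card_fin, nsmul_eq_mul]
        field_simp
        norm_num

end Empirical

/-! ### Stability of the empirical mean and covariance on good data sets -/

theorem sub_card_mul_norm_mean_sub_le {ι V : Type*} [Fintype ι] [NormedAddCommGroup V]
    [NormedSpace ℝ V] {p q : ι → V} {m₁ m₂ : V} (hm₁ : Fintype.card ι • m₁ = ∑ i, p i)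
    (hm₂ : Fintype.card ι • m₂ = ∑ i, q i) {r s : ℝ} (hp : ∀ i, ‖p i - m₁‖ ≤ r)
    (hq : ∀ i, ‖q i - m₂‖ ≤ s) {T : Finset ι} (hT : ∀ i ∉ T, p i = q i) :
    (Fintype.card ι - T.card) * ‖m₁ - m₂‖ ≤ T.card * (r + s) := by
  have hsum : Fintype.card ι • (m₁ - m₂) = ∑ i ∈ T, (p i - q i) := by
    rw [smul_sub, hm₁, hm₂, ← Finset.sum_sub_distrib]
    exact (Finset.sum_subset T.subset_univ fun i _ hi => sub_eq_zero.2 (hT i hi)).symm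
  have hterm : ∀ i, ‖p i - q i‖ ≤ r + s + ‖m₁ - m₂‖ := fun i => by
    have hsplit : p i - q i = (p i - m₁) - (q i - m₂) + (m₁ - m₂) := by abel
    rw [hsplit]
    refine (norm_add_le _ _).trans ?_
    gcongr
    exact (norm_sub_le _ _).trans (add_le_add (hp i) (hq i))
  have hnorm : Fintype.card ι * ‖m₁ - m₂‖ ≤ T.card * (r + s + ‖m₁ - m₂‖) := by
    rw [← nsmul_eq_mul, ← RCLike.norm_nsmul ℝ, hsum, ← nsmul_eq_mul]
    exact (norm_sum_le _ _).trans (Finset.sum_le_card_nsmul _ _ _ fun i _ => hterm i)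
  linarith

theorem abs_one_sub_one_div_le {D p q : ℝ} (hD : 0 < D) (hp : 0 ≤ p) (hp2 : p ≤ 1 / 2)
    (hq : 0 ≤ q) (h : D * (1 - q) = 1 - p) : |1 - 1 / D| ≤ q + 2 * p := by
  have hD2 : 1 / 2 ≤ D := by nlinarith
  have hsub : 1 - 1 / D = q - p / D := by
    field_simp
    linarith
  have hpD : p / D ≤ 2 * p := by
    rw [div_le_iff₀ hD]
    nlinarith
  have hpD0 : 0 ≤ p / D := by positivity
  rw [hsub, abs_le]
  constructor <;> linarith

theorem one_sub_sum_eq_mul_one_sub_sum {ι : Type*} [Fintype ι] {f g : ι → ℝ} {c D : ℝ}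
    (hD : D ≠ 0) (hf : c * ∑ i, f i = 1) (hg : c * ∑ i, g i = D) {T : Finset ι}
    (hT : ∀ i ∉ T, f i = g i) :
    D * (1 - c * ∑ i ∈ T, g i / D) = 1 - c * ∑ i ∈ T, f i := by
  have hdiff : ∑ i, f i - ∑ i, g i = ∑ i ∈ T, f i - ∑ i ∈ T, g i := by
    rw [← Finset.sum_sub_distrib, ← Finset.sum_sub_distrib]
    exact (Finset.sum_subset T.subset_univ fun i _ hi => sub_eq_zero.2 (hT i hi)).symm
  rw [← Finset.sum_div, mul_sub, mul_one, mul_div_assoc', mul_div_cancel₀ _ hD]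
  linear_combination hf - hg - c * hdiff

section Stability

open Matrix

variable {n d : ℕ} {lam k : ℝ} {z w : DataSet (3 * n) d} {A : Matrix (Fin d) (Fin d) ℝ}
  {D : Fin d → ℝ}

theorem inv_two_mul_sum_le {M : ℝ} (hM : 0 ≤ M) {f : Fin n → Fin d → ℝ}
    (hf : ∀ j, ∑ i, f j i ≤ 4 * M) {T : Finset (Fin n)} (hT : (T.card : ℝ) ≤ k) :
    ∑ i, 1 / (2 * (n : ℝ)) * ∑ j ∈ T, f j i ≤ 2 * k * M / n := by
  rw [← Finset.mul_sum, Finset.sum_comm]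
  calc 1 / (2 * (n : ℝ)) * ∑ j ∈ T, ∑ i, f j i
      ≤ 1 / (2 * (n : ℝ)) * (k * (4 * M)) := by
        gcongr
        refine (Finset.sum_le_card_nsmul _ _ _ fun j _ => hf j).trans ?_
        rw [nsmul_eq_mul]
        gcongr
    _ = 2 * k * M / n := by ring

/-- In coordinates whitening `Σ_z`, the vectors `p` and `q` collect the contributions to `Σ_z` and,
relative to `D`, to `Σ_w` of the pairs on which `z` and `w` differ. -/
theorem exists_covariance_perturbation (hn : 0 < n) (hA : IsUnit A) (hD : ∀ i, 0 < D i)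
    (hz : A * Aᵀ = empCov z) (hw : A * diagonal D * Aᵀ = empCov w) (hzG : z ∈ goodSet n d lam)
    (hwG : w ∈ goodSet n d lam) (hk : dataDist z w ≤ k) :
    ∃ p q : Fin d → ℝ, (∀ i, 0 ≤ p i) ∧ (∀ i, 0 ≤ q i) ∧ ∑ i, p i ≤ 2 * k * lam / n ∧
      ∑ i, q i ≤ 2 * k * lam / n ∧ ∀ i, D i * (1 - q i) = 1 - p i := by
  have hlam : 0 ≤ lam := by linarith [dim_le_of_mem_goodSet hzG hn, Nat.cast_nonneg (α := ℝ) d]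
  have hz' : A * diagonal (fun _ => 1) * Aᵀ = empCov z := by
    rw [diagonal_one, Matrix.mul_one, hz]
  obtain ⟨T, hTcard, hT⟩ := exists_finset_eqOn_compl (pairDiff z) (pairDiff w)
  have hTk : (T.card : ℝ) ≤ k :=
    le_trans (mod_cast hTcard.trans_le (dataDist_pairDiff_le z w)) hk
  set a : Fin n → Fin d → ℝ := fun j i => A⁻¹.toEuclideanLin (pairDiff z j) i ^ 2
  set b : Fin n → Fin d → ℝ := fun j i => A⁻¹.toEuclideanLin (pairDiff w j) i ^ 2
  have ha : ∀ j, ∑ i, a j i ≤ 4 * lam := fun j => by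
    rw [← EuclideanSpace.real_norm_sq_eq, ← mahalanobisSq_mul_transpose, hz]
    exact mahalanobisSq_pairDiff_le hzG j
  have hb : ∀ j, ∑ i, b j i / D i ≤ 4 * lam := fun j => by
    rw [← mahalanobisSq_mul_diagonal_mul_transpose fun i => (hD i).ne', hw]
    exact mahalanobisSq_pairDiff_le hwG j
  refine ⟨fun i => 1 / (2 * (n : ℝ)) * ∑ j ∈ T, a j i,
    fun i => 1 / (2 * (n : ℝ)) * ∑ j ∈ T, b j i / D i, fun i => by positivity,
    fun i => ?_, inv_two_mul_sum_le hlam ha hTk, inv_two_mul_sum_le hlam hb hTk, fun i => ?_⟩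
  · exact mul_nonneg (by positivity)
      (Finset.sum_nonneg fun j _ => div_nonneg (sq_nonneg _) (hD i).le)
  · exact one_sub_sum_eq_mul_one_sub_sum (hD i).ne' (sum_sq_whitened_pairDiff hA hz' i)
      (sum_sq_whitened_pairDiff hA hw i) fun j hj => congrArg (A⁻¹.toEuclideanLin · i ^ 2) (hT j hj)

theorem sum_abs_one_sub_one_div_le (hn : 0 < n) (hA : IsUnit A) (hD : ∀ i, 0 < D i)
    (hz : A * Aᵀ = empCov z) (hw : A * diagonal D * Aᵀ = empCov w) (hzG : z ∈ goodSet n d lam)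
    (hwG : w ∈ goodSet n d lam) (hk : dataDist z w ≤ k) (hγ : 2 * k * lam / n ≤ 1 / 2) :
    ∑ i, |1 - 1 / D i| ≤ 3 * (2 * k * lam / n) := by
  obtain ⟨p, q, hp, hq, hp_sum, hq_sum, hpq⟩ :=
    exists_covariance_perturbation hn hA hD hz hw hzG hwG hk
  have hp_le : ∀ i, p i ≤ 1 / 2 := fun i =>
    (Finset.single_le_sum (fun i _ => hp i) (Finset.mem_univ i)).trans (hp_sum.trans hγ)
  calc ∑ i, |1 - 1 / D i| ≤ ∑ i, (q i + 2 * p i) := Finset.sum_le_sum fun i _ =>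
        abs_one_sub_one_div_le (hD i) (hp i) (hp_le i) (hq i) (hpq i)
    _ = ∑ i, q i + 2 * ∑ i, p i := by rw [Finset.sum_add_distrib, Finset.mul_sum]
    _ ≤ 3 * (2 * k * lam / n) := by linarith

theorem covariance_ratio_le (hn : 0 < n) (hA : IsUnit A) (hD : ∀ i, 0 < D i)
    (hz : A * Aᵀ = empCov z) (hw : A * diagonal D * Aᵀ = empCov w) (hzG : z ∈ goodSet n d lam)
    (hwG : w ∈ goodSet n d lam) (hk : dataDist z w ≤ k) (hγ : 2 * k * lam / n < 1) (i : Fin d) :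
    D i ≤ 1 / (1 - 2 * k * lam / n) := by
  obtain ⟨p, q, hp, hq, -, hq_sum, hpq⟩ :=
    exists_covariance_perturbation hn hA hD hz hw hzG hwG hk
  have hq_le : q i ≤ 2 * k * lam / n :=
    (Finset.single_le_sum (fun i _ => hq i) (Finset.mem_univ i)).trans hq_sum
  rw [le_div_iff₀ (by linarith)]
  calc D i * (1 - 2 * k * lam / n) ≤ D i * (1 - q i) := by
        gcongr
        exact (hD i).le
    _ ≤ 1 := by linarith [hpq i, hp i]

theorem mahalanobisSq_empCov_le (hn : 0 < n) (hzG : z ∈ goodSet n d lam) (hwG : w ∈ goodSet n d lam)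
    (hk : dataDist z w ≤ k) (hγ : 2 * k * lam / n < 1) (v : EuclideanSpace ℝ (Fin d)) :
    mahalanobisSq (empCov z) v ≤ 1 / (1 - 2 * k * lam / n) * mahalanobisSq (empCov w) v := by
  obtain ⟨A, D, hA, hD, hz, hw⟩ :=
    exists_simultaneous_diagonalization (empCov_posDef hzG.1) (empCov_posDef hwG.1)
  rw [← hz, ← hw]
  exact mahalanobisSq_mul_transpose_le hD (covariance_ratio_le hn hA hD hz hw hzG hwG hk hγ) v

theorem card_nsmul_map_empMean {V : Type*} [AddCommGroup V] [Module ℝ V] (hn : 0 < n)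
    (L : EuclideanSpace ℝ (Fin d) →ₗ[ℝ] V) (x : DataSet (3 * n) d) :
    Fintype.card (Fin n) • L (empMean x) = ∑ j, L (meanRecords x j) := by
  rify at hn
  rw [Fintype.card_fin, ← Nat.cast_smul_eq_nsmul ℝ, empMean, map_smul, smul_smul,
    mul_one_div_cancel hn.ne', one_smul, map_sum]
  rfl

theorem sub_mul_norm_map_empMean_sub_le {V : Type*} [NormedAddCommGroup V] [NormedSpace ℝ V]
    (hn : 0 < n) (L : EuclideanSpace ℝ (Fin d) →ₗ[ℝ] V) (hk : dataDist z w ≤ k) {r : ℝ}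
    (hz : ∀ i, ‖L (z i - empMean z)‖ ≤ r) (hw : ∀ i, ‖L (w i - empMean w)‖ ≤ r) :
    (n - k) * ‖L (empMean z - empMean w)‖ ≤ 2 * k * r := by
  obtain ⟨T, hTcard, hT⟩ := exists_finset_eqOn_compl (meanRecords z) (meanRecords w)
  have hTk : (T.card : ℝ) ≤ k :=
    le_trans (mod_cast hTcard.trans_le (dataDist_meanRecords_le z w)) hk
  have hr : 0 ≤ r := (norm_nonneg _).trans (hz ⟨0, by lia⟩)
  have hmean := sub_card_mul_norm_mean_sub_le (card_nsmul_map_empMean hn L z)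
    (card_nsmul_map_empMean hn L w) (fun i => by rw [← map_sub]; exact hz _)
    (fun i => by rw [← map_sub]; exact hw _) fun i hi => congrArg L (hT i hi)
  rw [← map_sub, Fintype.card_fin] at hmean
  calc (n - k) * ‖L (empMean z - empMean w)‖
      ≤ (n - T.card) * ‖L (empMean z - empMean w)‖ := by gcongr
    _ ≤ T.card * (r + r) := hmean
    _ ≤ k * (r + r) := by gcongr
    _ = 2 * k * r := by ring

theorem mahalanobisSq_empMean_sub_le (hd : 0 < d) (hzG : z ∈ goodSet n d lam)
    (hwG : w ∈ goodSet n d lam) (hk : dataDist z w ≤ k) (hγ : 2 * k * lam / n < 1) :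
    (n * (1 - 2 * k * lam / n)) ^ 2 * mahalanobisSq (empCov z) (empMean z - empMean w)
      ≤ 4 * k ^ 2 * (lam / (1 - 2 * k * lam / n)) := by
  have hn := pos_of_mem_goodSet hzG hd
  have hn' : (0 : ℝ) < n := mod_cast hn
  have hlam : 1 ≤ 2 * lam := le_trans (mod_cast hd) (dim_le_of_mem_goodSet hzG hn)
  have hlam₀ : 0 ≤ lam := by linarith
  have hk₀ : 0 ≤ k := (Nat.cast_nonneg _).trans hk
  have hγ₀ : 0 ≤ 2 * k * lam / n := by positivity
  have hkn : k ≤ 2 * k * lam / n * n := by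
    rw [div_mul_cancel₀ _ hn'.ne']
    nlinarith
  have hw_le : ∀ v, mahalanobisSq (empCov z) v
      ≤ 1 / (1 - 2 * k * lam / n) * mahalanobisSq (empCov w) v :=
    mahalanobisSq_empCov_le hn hzG hwG hk hγ
  set γ := 2 * k * lam / n
  have hγ₁ : 0 < 1 - γ := by linarith
  have hlam_le : lam ≤ lam / (1 - γ) := le_div_self hlam₀ hγ₁ (by linarith)
  obtain ⟨A, -, -, -, hA, -⟩ :=
    exists_simultaneous_diagonalization (empCov_posDef hzG.1) (empCov_posDef hzG.1)
  have hnorm : ∀ v, mahalanobisSq (empCov z) v ≤ lam / (1 - γ) →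
      ‖A⁻¹.toEuclideanLin v‖ ≤ √(lam / (1 - γ)) := fun v hv =>
    Real.le_sqrt_of_sq_le (by rwa [← mahalanobisSq_mul_transpose, hA])
  have hmean := sub_mul_norm_map_empMean_sub_le hn A⁻¹.toEuclideanLin hk
    (fun i => hnorm _ ((hzG.2 i).trans hlam_le))
    (fun i => hnorm _ ((hw_le _).trans (by
      rw [one_div_mul_eq_div]
      exact div_le_div_of_nonneg_right (hwG.2 i) hγ₁.le)))
  rw [← hA, mahalanobisSq_mul_transpose, ← mul_pow]
  calc (n * (1 - γ) * ‖A⁻¹.toEuclideanLin (empMean z - empMean w)‖) ^ 2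
      ≤ (2 * k * √(lam / (1 - γ))) ^ 2 := by
        refine pow_le_pow_left₀ (by positivity) (le_trans ?_ hmean) 2
        gcongr
        linarith
    _ = 4 * k ^ 2 * (lam / (1 - γ)) := by
        rw [mul_pow, Real.sq_sqrt (by positivity)]
        ring

end Stability

/-! ### Closeness of the released Gaussian distributions -/

theorem two_mul_lt_log_one_div {ε δ : ℝ} (hδ : 0 < δ)
    (h : Real.exp ε * (1 + Real.exp ε) * δ < 1) : 2 * ε < Real.log (1 / δ) := by
  rw [Real.lt_log_iff_exp_lt (one_div_pos.2 hδ), lt_div_iff₀ hδ, two_mul, Real.exp_add]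
  have hpos : 0 < Real.exp ε * δ := by positivity
  linarith

theorem half_lt_log_one_div {ε δ : ℝ} (hε : 0 ≤ ε) (hδ : 0 < δ)
    (h : Real.exp ε * (1 + Real.exp ε) * δ < 1) : 1 / 2 < Real.log (1 / δ) := by
  have hexp : 1 ≤ Real.exp ε := Real.one_le_exp hε
  calc (1 / 2 : ℝ) < Real.log 2 := by linarith [Real.log_two_gt_d9]
    _ ≤ Real.log (1 / δ) := by
        refine Real.log_le_log two_pos ((le_div_iff₀ hδ).2 (le_trans ?_ h.le))
        gcongr
        nlinarith

theorem mul_le_of_sample_size {n K k lam ε L : ℝ} (hn : 0 < n) (hK : 100 ≤ K) (hk : 0 ≤ k)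
    (hlam : 0 ≤ lam) (hε : 0 < ε) (hL : 0 ≤ L) (h : K * (k * lam / ε * L) ≤ n) :
    2 * k * lam / n * L ≤ ε / 50 := by
  have h100 : 100 * (k * lam / ε * L) ≤ n :=
    (mul_le_mul_of_nonneg_right hK (by positivity)).trans h
  calc 2 * k * lam / n * L = 100 * (k * lam / ε * L) * (ε / (50 * n)) := by
        field_simp
        ring
    _ ≤ n * (ε / (50 * n)) := by gcongr
    _ = ε / 50 := by field_simp

theorem covariance_loss_bounds {ε L γ τ : ℝ} (hε : 0 < ε) (hL : 1 / 2 < L) (hτ : 0 ≤ τ)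
    (hγ : γ * L ≤ ε / 50) (hτγ : τ ≤ 3 * γ) :
    2 * L / ε * τ ≤ 1 / 2 ∧ 2 * (2 * L / ε * τ) ^ 2 ≤ 2 * L / ε * ε - L := by
  have hle : 2 * L / ε * τ ≤ 3 / 25 := by
    rw [div_mul_eq_mul_div, div_le_iff₀ hε]
    nlinarith
  have hsq : (2 * L / ε * τ) ^ 2 ≤ (3 / 25) ^ 2 := pow_le_pow_left₀ (by positivity) hle 2
  rw [div_mul_cancel₀ _ hε.ne']
  constructor <;> linarith

/-- The factor `32 = 8 * 4` in `C²` leaves `7 L Y ≤ ε² C²`, which at `α = 2L/ε` bounds `α² Y / C²`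
by `4L/7 ≤ L = α ε - L`. -/
theorem mean_loss_bound {n k ε L l γ X Y : ℝ} (hn : 0 < n) (hk : 0 < k) (hε : 0 < ε) (hL : 0 < L)
    (hLl : L ≤ l) (hεL : ε ≤ 2 * L) (hγ : γ ≤ 1 / 100) (hX : 0 < X) (hY₀ : 0 ≤ Y)
    (hY : (n * (1 - γ)) ^ 2 * Y ≤ 4 * k ^ 2 * X) :
    (2 * L / ε + (2 * L / ε) ^ 2) / 2 * ((32 * k ^ 2 / (ε ^ 2 * n ^ 2) * X * l)⁻¹ * Y)
      ≤ 2 * L / ε * ε - L := by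
  have hl : 0 < l := hL.trans_le hLl
  have hα : 1 ≤ 2 * L / ε := (one_le_div hε).2 hεL
  have hY7 : 7 * n ^ 2 * Y ≤ 32 * k ^ 2 * X := by
    have hγ7 : 7 / 8 ≤ (1 - γ) ^ 2 := by nlinarith
    have := mul_le_mul_of_nonneg_right hγ7 (mul_nonneg (sq_nonneg n) hY₀)
    linarith
  have hloss : (32 * k ^ 2 / (ε ^ 2 * n ^ 2) * X * l)⁻¹ * Y ≤ ε ^ 2 / (7 * L) := by
    rw [inv_mul_eq_div, div_le_div_iff₀ (by positivity) (by positivity)]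
    calc Y * (7 * L) = 7 * n ^ 2 * Y * (L / n ^ 2) := by field_simp
      _ ≤ 32 * k ^ 2 * X * (l / n ^ 2) := by gcongr
      _ = ε ^ 2 * (32 * k ^ 2 / (ε ^ 2 * n ^ 2) * X * l) := by field_simp
  calc (2 * L / ε + (2 * L / ε) ^ 2) / 2 * ((32 * k ^ 2 / (ε ^ 2 * n ^ 2) * X * l)⁻¹ * Y)
      ≤ (2 * L / ε) ^ 2 * (ε ^ 2 / (7 * L)) := by
        gcongr
        nlinarith
    _ = 4 * L / 7 := by
        field_simp
        norm_num
    _ ≤ 2 * L / ε * ε - L := by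
        rw [div_mul_cancel₀ _ hε.ne']
        linarith

section Release

open Matrix

variable {n d : ℕ} {ε δ lam k : ℝ} {z w : DataSet (3 * n) d}

theorem sqrt_smul_mul_mul_transpose {m : Type*} [Fintype m] {c : ℝ} (hc : 0 ≤ c)
    (A M : Matrix m m ℝ) : (√c • A) * M * (√c • A)ᵀ = c • (A * M * Aᵀ) := by
  rw [transpose_smul, Matrix.smul_mul, Matrix.smul_mul, Matrix.mul_smul, smul_smul,
    Real.mul_self_sqrt hc]

theorem noiseScaleSq_pos (hn : 0 < n) (hε : 0 < ε) (hδ : 0 < δ) (hL : 0 < Real.log (1 / δ))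
    (hlam : 0 < lam) (hk : 0 < k) (hγ : 2 * k * lam / n < 1) : 0 < noiseScaleSq n ε δ lam k := by
  have hlog : 0 < Real.log (1.25 / δ) :=
    hL.trans_le (Real.log_le_log (by positivity) (by gcongr; norm_num))
  have hX : 0 < lam / (1 - 2 * k * lam / n) := div_pos hlam (by linarith)
  exact mul_pos (mul_pos (by positivity) hX) hlog

theorem maxDivergenceLE_multivariateGaussian_empMean (hd : 0 < d) (hε : 0 < ε) (hδ : 0 < δ)
    (hεL : 2 * ε < Real.log (1 / δ)) (hzG : z ∈ goodSet n d lam) (hwG : w ∈ goodSet n d lam)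
    (hk₀ : 0 < k) (hk : dataDist z w ≤ k) (hγ : 2 * k * lam / n ≤ 1 / 100) :
    MaxDivergenceLE ε δ
      (multivariateGaussian (empMean z) (noiseScaleSq n ε δ lam k • empCov z))
      (multivariateGaussian (empMean w) (noiseScaleSq n ε δ lam k • empCov z)) := by
  have hn := pos_of_mem_goodSet hzG hd
  have hlam : 0 < lam := by
    linarith [dim_le_of_mem_goodSet hzG hn, show (0 : ℝ) < d from mod_cast hd]
  have hL : 0 < Real.log (1 / δ) := by linarith
  have hC := noiseScaleSq_pos hn hε hδ hL hlam hk₀ (by linarith)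
  refine maxDivergenceLE_multivariateGaussian_mean ((empCov_posDef hzG.1).smul hC) _ _
    (α := 2 * Real.log (1 / δ) / ε) (by positivity) hδ ?_
  rw [mahalanobisSq_smul hC.ne' hzG.1]
  refine mean_loss_bound (mod_cast hn) hk₀ hε hL ?_ (by linarith) hγ ?_ ?_
    (mahalanobisSq_empMean_sub_le hd hzG hwG hk (by linarith))
  · exact Real.log_le_log (by positivity) (by gcongr; norm_num)
  · exact div_pos hlam (by linarith)
  · exact (empCov_posDef hzG.1).inv.posSemidef.dotProduct_mulVec_nonneg _

theorem maxDivergenceLE_multivariateGaussian_empCov (hn : 0 < n) (hε : 0 < ε) (hδ : 0 < δ)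
    (hεL : 2 * ε < Real.log (1 / δ)) (hL : 1 / 2 < Real.log (1 / δ)) (hzG : z ∈ goodSet n d lam)
    (hwG : w ∈ goodSet n d lam) (hk : dataDist z w ≤ k)
    (hγL : 2 * k * lam / n * Real.log (1 / δ) ≤ ε / 50) (hγ : 2 * k * lam / n ≤ 1 / 2) {c : ℝ}
    (hc : 0 ≤ c) (μ : EuclideanSpace ℝ (Fin d)) :
    MaxDivergenceLE ε δ (multivariateGaussian μ (c • empCov z))
      (multivariateGaussian μ (c • empCov w)) := by
  obtain ⟨A, D, hA, hD, hz, hw⟩ :=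
    exists_simultaneous_diagonalization (empCov_posDef hzG.1) (empCov_posDef hwG.1)
  obtain ⟨hsmall, hloss⟩ := covariance_loss_bounds hε hL
    (Finset.sum_nonneg fun i _ => abs_nonneg (1 - 1 / D i)) hγL
    (sum_abs_one_sub_one_div_le hn hA hD hz hw hzG hwG hk hγ)
  have hcov := maxDivergenceLE_multivariateGaussian_cov μ (√c • A) hD
    ((one_le_div hε).2 (by linarith)) hδ hsmall hloss
  have hz' := sqrt_smul_mul_mul_transpose hc A 1
  rw [Matrix.mul_one, Matrix.mul_one, hz] at hz'
  rwa [hz', sqrt_smul_mul_mul_transpose hc, hw] at hcov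

theorem maxDivergenceLE_releaseGaussian {K : ℝ} (hK : 100 ≤ K) (hε : 0 < ε) (hδ : 0 < δ)
    (hsmall : Real.exp ε * (1 + Real.exp ε) * δ < 1)
    (hn : K * (k * lam / ε * Real.log (1 / δ)) ≤ n) (hzG : z ∈ goodSet n d lam)
    (hwG : w ∈ goodSet n d lam) (hk : dataDist z w ≤ k) :
    MaxDivergenceLE (2 * ε) ((1 + Real.exp ε) * δ) (releaseGaussian (noiseScaleSq n ε δ lam k) z)
      (releaseGaussian (noiseScaleSq n ε δ lam k) w) := by
  rcases eq_or_ne z w with rfl | hzw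
  · exact .refl (by positivity) _
  have hd : 0 < d := by
    rcases Nat.eq_zero_or_pos d with rfl | hd
    · exact absurd (Subsingleton.elim z w) hzw
    · exact hd
  have hk₀ : 0 < k := lt_of_lt_of_le (mod_cast hammingDist_pos.2 hzw) hk
  have hεL := two_mul_lt_log_one_div hδ hsmall
  have hL := half_lt_log_one_div hε.le hδ hsmall
  have hn₀ := pos_of_mem_goodSet hzG hd
  have hlam : 0 < lam := by
    linarith [dim_le_of_mem_goodSet hzG hn₀, show (0 : ℝ) < d from mod_cast hd]
  have hγL := mul_le_of_sample_size (mod_cast hn₀) hK hk₀.le hlam.le hε (by linarith) hn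
  have hγ₀ : 0 ≤ 2 * k * lam / n := by positivity
  have hγ : 2 * k * lam / n ≤ 1 / 100 :=
    le_of_mul_le_mul_right (a := 2 * ε) (by nlinarith) (by positivity)
  have hC := noiseScaleSq_pos hn₀ hε hδ (by linarith) hlam hk₀ (by linarith)
  have h := (maxDivergenceLE_multivariateGaussian_empMean hd hε hδ hεL hzG hwG hk₀ hk hγ).trans
    (maxDivergenceLE_multivariateGaussian_empCov hn₀ hε hδ hεL hL hzG hwG hk hγL (by linarith) hC.le
      (empMean w)) hδ.le hδ.le
  rwa [← two_mul, ← one_add_mul] at h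

end Release

/-! ### Privacy of the mechanism -/

theorem rescaledGaussian_comp_perm (K c : ℝ) {n d : ℕ} (ε δ β : ℝ)
    (proj : DataSet (3 * n) d → DataSet (3 * n) d) (x : DataSet (3 * n) d)
    (π : Equiv.Perm (Fin (3 * n))) :
    rescaledGaussian K c ε δ β proj (x ∘ π) = rescaledGaussian K c ε δ β proj x := by
  unfold rescaledGaussian
  dsimp only
  congr 1
  exact Fintype.sum_equiv (Equiv.mulLeft π) _ _ fun _ => rfl

theorem maxDivergenceLE_rescaledGaussian {K c : ℝ} {n d : ℕ} {ε δ β : ℝ} (hK : 100 ≤ K)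
    (hε : 0 < ε) (hδ : 0 < δ) (hβ : 0 < β) {proj : DataSet (3 * n) d → DataSet (3 * n) d}
    (hp : IsProjection (goodSet n d (lamParam c n d β)) proj) {x y : DataSet (3 * n) d}
    (hxy : Neighboring x y) :
    MaxDivergenceLE (3 * ε) (Real.exp ε * (1 + Real.exp ε) * δ)
      (rescaledGaussian K c ε δ β proj x) (rescaledGaussian K c ε δ β proj y) := by
  have := isProbabilityMeasure_rescaledGaussian K c hε δ β proj x
  rcases le_or_gt 1 (Real.exp ε * (1 + Real.exp ε) * δ) with hlarge | hsmall
  · exact .of_one_le hlarge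
  have hexp : 1 ≤ Real.exp ε := Real.one_le_exp hε.le
  have hδ1 : δ ≤ 1 := by nlinarith [mul_pos (Real.exp_pos ε) hδ]
  unfold rescaledGaussian
  dsimp only
  split_ifs with hn
  · exact .refl (by positivity) _
  refine .uniform_mixture fun σ => ?_
  rw [show 3 * ε = ε + 2 * ε by ring, mul_assoc]
  refine maxDivergenceLE_afterPermutation hε hδ hδ1 hβ (by positivity) (by nlinarith) hp
    (fun z hz w hw hk => ?_) ((dataDist_comp_perm x y σ).trans_le hxy)
  exact maxDivergenceLE_releaseGaussian hK hε hδ hsmall (not_lt.1 hn) hz hw hk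

theorem isDifferentiallyPrivate_rescaledGaussian {K c : ℝ} {n d : ℕ} {ε δ β : ℝ} (hK : 100 ≤ K)
    (hε : 0 < ε) (hδ : 0 < δ) (hβ : 0 < β) {proj : DataSet (3 * n) d → DataSet (3 * n) d}
    (hp : IsProjection (goodSet n d (lamParam c n d β)) proj) :
    IsDifferentiallyPrivate Neighboring (3 * ε) (Real.exp ε * (1 + Real.exp ε) * δ)
      (rescaledGaussian K c ε δ β proj) := fun x y hxy =>
  indistinguishable_iff_maxDivergenceLE.2 ⟨maxDivergenceLE_rescaledGaussian hK hε hδ hβ hp hxy,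
    maxDivergenceLE_rescaledGaussian hK hε hδ hβ hp ((dataDist_comm y x).trans_le hxy)⟩

theorem corollary4p12 :
    ∃ K₀ : ℝ, 0 < K₀ ∧
      ∀ (K c : ℝ) (n d : ℕ) (ε δ β : ℝ)
        (proj : DataSet (3 * n) d → DataSet (3 * n) d),
        K₀ ≤ K → 0 < c → 0 < ε → 0 < δ → δ < 1 → 0 < β →
        IsProjection (goodSet n d (lamParam c n d β)) proj →
        IsDifferentiallyPrivate Neighboring
            (3 * ε) (Real.exp ε * (1 + Real.exp ε) * δ) (rescaledGaussian K c ε δ β proj) ∧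
          IsDifferentiallyPrivate MultisetNeighboring
            (3 * ε) (Real.exp ε * (1 + Real.exp ε) * δ) (rescaledGaussian K c ε δ β proj) := by
  refine ⟨100, by norm_num, fun K c n d ε δ β proj hK _ hε hδ _ hβ hp => ?_⟩
  have hprivate := isDifferentiallyPrivate_rescaledGaussian hK hε hδ hβ hp
  refine ⟨hprivate, fun x y ⟨π, hπ⟩ => ?_⟩
  rw [← rescaledGaussian_comp_perm K c ε δ β proj y π]
  exact hprivate x _ hπ
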